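/- Let $\breve\chi>0$, $\breve\tau>0$, $\breve\lambda>0$ be real numbers with $$2\pi\breve\chi(\breve\tau+1)>\breve\lambda .$$ Let $\mathbb T_{2\pi}=\mathbb R/2\pi\mathbb Z$ and, for $\sigma\ge 0$, consider on $\mathbb L^2_\theta=(L^2(\mathbb T_{2\pi},\mathbb C))^2$ the operator $$\mathsf L_\sigma\mathbf A=\sigma\frac{d^2}{d\theta^2}\mathbf A+\mathsf V_{\breve\lambda}\mathbf A+\breve\chi\,\mathsf B_{\breve\tau}\overline{\mathbf A},\qquad \overline{\mathbf A}=\int_0^{2\pi}\mathbf A(\theta)\,d\theta\in\mathbb C^2,$$ $$\mathsf V_{\breve\lambda}=\breve\lambda\begin{pmatrix}0&-\cos\theta\\ \cos\theta&0\end{pmatrix},\qquad \mathsf B_{\breve\tau}=\begin{pmatrix}-\breve\tau\cos 2\theta&\cos\theta\\-\cos\theta&-\breve\tau\cos2\theta\end{pmatrix},$$ with domain $(H^2(\mathbb T_{2\pi},\mathbb C))^2$ if $\sigma>0$, and with domain all of $\mathbb L^2_\theta$ if $\sigma=0$. Then there exists $\sigma^*>0$ (depending on $\breve\chi,\breve\tau,\breve\lambda$)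 such that for every $\sigma\in[0,\sigma^*)$ the operator $\mathsf L_\sigma$ has a real, strictly positive eigenvalue $\mu$ which is an isolated point of its spectrum and has multiplicity $2$: both the eigenspace $\ker(\mathsf L_\sigma-\mu)$ and the generalized eigenspace $\bigcup_{n}\ker(\mathsf L_\sigma-\mu)^n$ have complex dimension $2$. -/

import Mathlib

open MeasureTheory Filter Topology
open scoped ENNReal ContDiff

noncomputable section

namespace AngularOperator

instance factTwoPiPos : Fact (0 < 2 * Real.pi) := ⟨Real.two_pi_pos⟩

/-- The torus `ℝ / 2πℤ`; its volume is the (non-normalised) measure `dθ`, of total mass `2π`. -/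
abbrev Circ : Type := AddCircle (2 * Real.pi)

/-- `L²(𝕋_{2π}, ℂ)`. -/
abbrev L2 : Type := Lp ℂ 2 (volume : Measure Circ)

/-- The Hilbert space `(L²(𝕋_{2π}, ℂ))²` with its natural (Hilbert) norm. -/
abbrev L2Vec : Type := WithLp 2 (L2 × L2)

/-- The first component of a pair, as a linear map. -/
def fstL : L2Vec →ₗ[ℂ] L2 := LinearMap.fst ℂ L2 L2 ∘ₗ (WithLp.linearEquiv 2 ℂ (L2 × L2)).toLinearMap

/-- The second component of a pair, as a linear map. -/
def sndL : L2Vec →ₗ[ℂ] L2 := LinearMap.snd ℂ L2 L2 ∘ₗ (WithLp.linearEquiv 2 ℂ (L2 × L2)).toLinearMap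

/-- Assemble two linear maps into `(L²)²` into one linear map. -/
def pairL {E : Type*} [AddCommGroup E] [Module ℂ E] (f g : E →ₗ[ℂ] L2) : E →ₗ[ℂ] L2Vec :=
  (WithLp.linearEquiv 2 ℂ (L2 × L2)).symm.toLinearMap ∘ₗ f.prod g

/-! ### Multiplication by cosines, and the integral over the circle -/

/-- The function `θ ↦ cos (n θ)` on the torus. -/
def circCos (n : ℕ) : C(Circ, ℂ) where
  toFun θ := ((Real.cos_periodic.lift (n • θ) : ℝ) : ℂ)
  continuous_toFun := by
    have h : Continuous (Real.cos_periodic.lift : AddCircle (2 * Real.pi) → ℝ) :=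
      continuous_coinduced_dom.mpr Real.continuous_cos
    exact Complex.continuous_ofReal.comp (h.comp (continuous_nsmul n))

theorem circCos_coe (n : ℕ) (x : ℝ) : circCos n (x : Circ) = (Real.cos (n * x) : ℂ) := by
  have h : n • (x : Circ) = ((n * x : ℝ) : Circ) := by
    rw [← nsmul_eq_mul]; rfl
  change ((Real.cos_periodic.lift (n • (x : Circ)) : ℝ) : ℂ) = _
  rw [h, Function.Periodic.lift_coe]

/-- Multiplication by a continuous function on `L²`. -/
def mulOp (g : C(Circ, ℂ)) : L2 →ₗ[ℂ] L2 :=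
  ((ContinuousLinearMap.mul ℂ ℂ).holderL volume ∞ 2 2
    (ContinuousMap.toLp (E := ℂ) ∞ (volume : Measure Circ) ℂ g)).toLinearMap

theorem coeFn_mulOp (g : C(Circ, ℂ)) (u : L2) :
    (mulOp g u : Circ → ℂ) =ᵐ[volume] fun θ => g θ * u θ := by
  filter_upwards [(ContinuousLinearMap.mul ℂ ℂ).coeFn_holder (r := 2)
    (ContinuousMap.toLp (E := ℂ) ∞ (volume : Measure Circ) ℂ g) u,
    ContinuousMap.coeFn_toLp (E := ℂ) (p := ∞) (𝕜 := ℂ) (volume : Measure Circ) g] with θ h1 h2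
  refine h1.trans ?_
  rw [h2]; rfl

/-- The integral `ū = ∫ u(θ) dθ` over the circle. -/
def bar : L2 →ₗ[ℂ] ℂ where
  toFun u := ∫ θ, u θ
  map_add' u v := by
    rw [← integral_add ((Lp.memLp u).integrable (by norm_num))
      ((Lp.memLp v).integrable (by norm_num))]
    exact integral_congr_ae (Lp.coeFn_add u v)
  map_smul' c u := by
    rw [RingHom.id_apply, ← integral_smul]
    exact integral_congr_ae (Lp.coeFn_smul c u)

/-- The function `θ ↦ cos (n θ)` as an element of `L²`. -/
def cosL2 (n : ℕ) : L2 := ContinuousMap.toLp (E := ℂ) 2 (volume : Measure Circ) ℂ (circCos n)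

/-- The operator `A = (a, b) ↦ lam (-cos(θ) b, cos(θ) a)`. -/
def opV (lam : ℝ) : L2Vec →ₗ[ℂ] L2Vec :=
  (lam : ℂ) • pairL (-(mulOp (circCos 1) ∘ₗ sndL)) (mulOp (circCos 1) ∘ₗ fstL)

/-- The finite rank operator
`A = (a, b) ↦ (-tau cos(2θ) ā + cos(θ) b̄, -cos(θ) ā - tau cos(2θ) b̄)`. -/
def opBbar (tau : ℝ) : L2Vec →ₗ[ℂ] L2Vec :=
  pairL
    ((bar ∘ₗ fstL).smulRight (-(tau : ℂ) • cosL2 2) + (bar ∘ₗ sndL).smulRight (cosL2 1))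
    ((bar ∘ₗ fstL).smulRight (-cosL2 1) + (bar ∘ₗ sndL).smulRight (-(tau : ℂ) • cosL2 2))

/-! ### Weak derivatives and the second derivative operator -/

/-- `v` is the weak (distributional) derivative of `u` on the torus; test functions are the smooth
`2π`-periodic functions. -/
def IsWeakDeriv (u v : L2) : Prop :=
  ∀ φ : ℝ → ℂ, ContDiff ℝ ∞ φ → Function.Periodic φ (2 * Real.pi) →
    ∫ x in (0)..(2 * Real.pi), u (x : Circ) * deriv φ x =
      -∫ x in (0)..(2 * Real.pi), v (x : Circ) * φ x

theorem intervalIntegrable_mul (u : L2) {φ : ℝ → ℂ} (hφ : Continuous φ) :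
    IntervalIntegrable (fun x : ℝ => u (x : Circ) * φ x) volume 0 (2 * Real.pi) := by
  have h0 : Integrable (u : Circ → ℂ) volume := (Lp.memLp u).integrable (by norm_num)
  have hmp := AddCircle.measurePreserving_mk (2 * Real.pi) 0
  have h1 : Integrable (fun x : ℝ => u (x : Circ))
      (volume.restrict (Set.Ioc 0 (0 + 2 * Real.pi))) :=
    hmp.integrable_comp_of_integrable h0
  rw [zero_add] at h1
  have h2 : IntervalIntegrable (fun x : ℝ => u (x : Circ)) volume 0 (2 * Real.pi) :=
    (intervalIntegrable_iff_integrableOn_Ioc_of_le Real.two_pi_pos.le).2 h1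
  exact h2.mul_continuousOn hφ.continuousOn

theorem integral_congr_L2 {f g : Circ → ℂ} (h : f =ᵐ[volume] g) (φ : ℝ → ℂ) :
    ∫ x in (0)..(2 * Real.pi), f (x : Circ) * φ x =
      ∫ x in (0)..(2 * Real.pi), g (x : Circ) * φ x := by
  rw [intervalIntegral.integral_of_le Real.two_pi_pos.le,
    intervalIntegral.integral_of_le Real.two_pi_pos.le]
  have hmp := AddCircle.measurePreserving_mk (2 * Real.pi) 0
  rw [zero_add] at hmp
  refine integral_congr_ae ?_
  filter_upwards [hmp.quasiMeasurePreserving.ae h] with x hx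
  rw [hx]

theorem integral_add_L2 (u v : L2) {φ : ℝ → ℂ} (hφ : Continuous φ) :
    ∫ x in (0)..(2 * Real.pi), (u + v : L2) (x : Circ) * φ x =
      (∫ x in (0)..(2 * Real.pi), u (x : Circ) * φ x) +
        ∫ x in (0)..(2 * Real.pi), v (x : Circ) * φ x := by
  rw [integral_congr_L2 (Lp.coeFn_add u v) φ, ← intervalIntegral.integral_add
    (intervalIntegrable_mul u hφ) (intervalIntegrable_mul v hφ)]
  simp only [Pi.add_apply, add_mul]

theorem integral_smul_L2 (c : ℂ) (u : L2) (φ : ℝ → ℂ) :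
    ∫ x in (0)..(2 * Real.pi), (c • u : L2) (x : Circ) * φ x =
      c * ∫ x in (0)..(2 * Real.pi), u (x : Circ) * φ x := by
  rw [integral_congr_L2 (Lp.coeFn_smul c u) φ, ← intervalIntegral.integral_const_mul]
  simp only [Pi.smul_apply, smul_eq_mul, mul_assoc]

theorem isWeakDeriv_zero : IsWeakDeriv 0 0 := by
  intro φ _ _
  have h (ψ : ℝ → ℂ) : ∫ x in (0)..(2 * Real.pi), (0 : L2) (x : Circ) * ψ x = 0 := by
    rw [integral_congr_L2 (Lp.coeFn_zero ℂ 2 (volume : Measure Circ)) ψ]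
    simp
  rw [h, h, neg_zero]

theorem IsWeakDeriv.add {u v u' v' : L2} (h : IsWeakDeriv u v) (h' : IsWeakDeriv u' v') :
    IsWeakDeriv (u + u') (v + v') := by
  intro φ hφ hp
  rw [integral_add_L2 _ _ (hφ.continuous_deriv (by simp)), integral_add_L2 _ _ hφ.continuous,
    h φ hφ hp, h' φ hφ hp, neg_add]

theorem IsWeakDeriv.smul {u v : L2} (c : ℂ) (h : IsWeakDeriv u v) :
    IsWeakDeriv (c • u) (c • v) := by
  intro φ hφ hp
  rw [integral_smul_L2, integral_smul_L2, h φ hφ hp, mul_neg]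

/-- The weak derivative is unique. -/
theorem IsWeakDeriv.eq_zero {v : L2} (h : IsWeakDeriv 0 v) : v = 0 := by
  have hv : MemLp (v : Circ → ℂ) 2 AddCircle.haarAddCircle := (Lp.memLp v).haarAddCircle
  have hc : ∀ n : ℤ, fourierCoeff (v : Circ → ℂ) n = 0 := by
    intro n
    have hsm : ContDiff ℝ ∞ (fun x : ℝ => fourier (-n) (x : Circ)) := by
      simp only [fourier_coe_apply]
      refine ContDiff.cexp (ContDiff.div_const (contDiff_const.mul ?_) _)
      exact Complex.ofRealCLM.contDiff
    have hp : Function.Periodic (fun x : ℝ => fourier (-n) (x : Circ)) (2 * Real.pi) := by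
      intro x
      simp only [AddCircle.coe_add_period]
    have h1 := h _ hsm hp
    rw [integral_congr_L2 (Lp.coeFn_zero ℂ 2 (volume : Measure Circ))] at h1
    simp only [Pi.zero_apply, zero_mul, intervalIntegral.integral_zero] at h1
    rw [fourierCoeff_eq_intervalIntegral _ n 0, zero_add]
    simp only [smul_eq_mul, mul_comm (fourier (-n) _) _]
    rw [neg_eq_zero.mp h1.symm, smul_zero]
  have hz : hv.toLp = 0 := by
    apply fourierBasis.repr.injective
    ext n
    rw [fourierBasis_repr, fourierCoeff_congr_ae hv.coeFn_toLp, hc n, map_zero]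
    rfl
  have hae : (v : Circ → ℂ) =ᵐ[AddCircle.haarAddCircle] 0 := by
    refine hv.coeFn_toLp.symm.trans ?_
    rw [hz]
    exact Lp.coeFn_zero _ _ _
  rw [Lp.eq_zero_iff_ae_eq_zero]
  exact Measure.ae_smul_measure hae (ENNReal.ofReal (2 * Real.pi))

/-- The graph of the second weak derivative with domain `H²(𝕋_{2π}, ℂ)`: the pairs `(u, w)` such
that `u` has a weak derivative in `L²` whose weak derivative is `w ∈ L²`. -/
def secondDerivGraph : Submodule ℂ (L2 × L2) where
  carrier := {p | ∃ v : L2, IsWeakDeriv p.1 v ∧ IsWeakDeriv v p.2}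
  zero_mem' := ⟨0, isWeakDeriv_zero, isWeakDeriv_zero⟩
  add_mem' := by
    rintro p q ⟨v, h1, h2⟩ ⟨v', h1', h2'⟩
    exact ⟨v + v', h1.add h1', h2.add h2'⟩
  smul_mem' := by
    rintro c p ⟨v, h1, h2⟩
    exact ⟨c • v, h1.smul c, h2.smul c⟩

/-- `d²/dθ²` as an unbounded operator on `L²` with domain `H²`. -/
def secondDeriv : L2 →ₗ.[ℂ] L2 := secondDerivGraph.toLinearPMap

theorem secondDeriv_graph : secondDeriv.graph = secondDerivGraph := by
  refine Submodule.toLinearPMap_graph_eq _ ?_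
  rintro ⟨u, w⟩ ⟨v, h1, h2⟩ h0
  obtain rfl : u = 0 := h0
  obtain rfl := h1.eq_zero
  exact h2.eq_zero

/-- `d²/dθ²` acting componentwise on `(L²)²`, with domain `H² × H²`. -/
def secondDerivVec : L2Vec →ₗ.[ℂ] L2Vec where
  domain := secondDeriv.domain.comap fstL ⊓ secondDeriv.domain.comap sndL
  toFun := pairL
    (secondDeriv.toFun ∘ₗ (fstL ∘ₗ Submodule.subtype _).codRestrict _ fun x => x.2.1)
    (secondDeriv.toFun ∘ₗ (sndL ∘ₗ Submodule.subtype _).codRestrict _ fun x => x.2.2)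

/-- `σ d²/dθ²` on `(L²)²`: for `σ = 0` it is the zero operator, defined everywhere; otherwise
its domain is `H² × H²`. -/
def diffusion (σ : ℝ) : L2Vec →ₗ.[ℂ] L2Vec :=
  if σ = 0 then 0 else (σ : ℂ) • secondDerivVec

/-- The operator `σ d²/dθ² + V_lam + chi B_tau \overline{·}` on `(L²)²`. -/
def opL (chi tau lam σ : ℝ) : L2Vec →ₗ.[ℂ] L2Vec :=
  (opV lam + (chi : ℂ) • opBbar tau) +ᵥ diffusion σ

/-! ### Spectral notions for unbounded operators -/

section Spectral

variable {H : Type*} [NormedAddCommGroup H] [NormedSpace ℂ H]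

/-- The subspace `{x ∈ D(T) | T x - z x ∈ S}`. -/
def shiftPreimage (T : H →ₗ.[ℂ] H) (z : ℂ) (S : Submodule ℂ H) : Submodule ℂ H :=
  (S.comap (T.toFun - z • T.domain.subtype)).map T.domain.subtype

theorem mem_shiftPreimage (T : H →ₗ.[ℂ] H) (z : ℂ) (S : Submodule ℂ H) (x : H) :
    x ∈ shiftPreimage T z S ↔ ∃ h : x ∈ T.domain, T ⟨x, h⟩ - z • x ∈ S := by
  constructor
  · rintro ⟨⟨y, hy⟩, h, rfl⟩
    exact ⟨hy, h⟩
  · rintro ⟨hx, h⟩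
    exact ⟨⟨x, hx⟩, h, rfl⟩

/-- `ker (T - z)ⁿ`, on the natural domain of the `n`-th power. -/
def kerPow (T : H →ₗ.[ℂ] H) (z : ℂ) : ℕ → Submodule ℂ H
  | 0 => ⊥
  | n + 1 => shiftPreimage T z (kerPow T z n)

/-- The eigenspace `ker (T - z)`. -/
def eigenspace (T : H →ₗ.[ℂ] H) (z : ℂ) : Submodule ℂ H := kerPow T z 1

theorem mem_eigenspace (T : H →ₗ.[ℂ] H) (z : ℂ) (x : H) :
    x ∈ eigenspace T z ↔ ∃ h : x ∈ T.domain, T ⟨x, h⟩ = z • x := by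
  refine (mem_shiftPreimage T z ⊥ x).trans ?_
  simp only [Submodule.mem_bot, sub_eq_zero]

/-- The generalised eigenspace `⋃ₙ ker (T - z)ⁿ`. -/
def genEigenspace (T : H →ₗ.[ℂ] H) (z : ℂ) : Submodule ℂ H := ⨆ n, kerPow T z n

/-- The resolvent set: those `z` for which `z - T : D(T) → H` has a bounded everywhere defined
two-sided inverse. -/
def resolventSet (T : H →ₗ.[ℂ] H) : Set ℂ :=
  {z | ∃ R : H →L[ℂ] H,
    (∀ y, ∃ h : R y ∈ T.domain, z • R y - T ⟨R y, h⟩ = y) ∧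
    ∀ x : T.domain, R (z • (x : H) - T x) = x}

/-- `z` is an eigenvalue of `T`. -/
def IsEigenvalue (T : H →ₗ.[ℂ] H) (z : ℂ) : Prop := eigenspace T z ≠ ⊥

/-- A punctured neighbourhood of `z` is contained in the resolvent set of `T`. -/
def IsIsolated (T : H →ₗ.[ℂ] H) (z : ℂ) : Prop := ∀ᶠ w in 𝓝[≠] z, w ∈ resolventSet T

end Spectral

end AngularOperator

end

namespace AngularOperator

open scoped InnerProductSpace ComplexConjugate

/-! ### Resolvents of skew perturbations -/

section Skew

variable {E : Type*} [NormedAddCommGroup E] [InnerProductSpace ℂ E]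

/-! The two components decouple. With `c = a + i b` the matrix part becomes multiplication by `i λ
cos θ`, and the nonlocal part sends `c` to `-χ (τ cos 2θ + i cos θ)` times the integral of `c`; for
`a - i b` the coefficients are conjugated. Twisting the `n`-th Fourier coefficient by `(-i)ⁿ`,
respectively `iⁿ`, turns both into the same operator `M = A - πχ ⟨e₀, ·⟩ s` on `ℓ²(ℤ)`, where `A` is
`-σ n²` plus a bounded skew difference operator and `s` is the finitely supported `source`. This is
`isDoubleMode_opL`, and it explains the multiplicity 2: each copy contributes a simple eigenvalue.

Since `A` is dissipative, `R(z) = (z - A)⁻¹` exists for `Re z > 0` with norm at most `1 / Re z`,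
uniformly in `σ` (`exists_resolvent`). The perturbation has rank one, so everything is read off from
the scalar function `D(z) = 1 + πχ (R(z) s)₀`: where `D ≠ 0` the Sherman–Morrison formula gives the
resolvent of `M`, a zero of `D` is an eigenvalue with eigenvector `R(z) s`, and `D' ≠ 0` makes it
isolated and excludes Jordan chains (`eq_zero_of_modeRel_add`).

It remains to find a simple positive zero. For `σ = 0` the substitution `x = λ (1/q - q) / 2` makes
`D` an explicit rational function of `q` in `(0, 1)`. It is `1` at `q = 0` and negative at `q = 1`
exactly by the assumed inequality; it decreases in `q`, as does `x`, so `D` has a zero with `D' > 0`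
(`exists_root_disp_zero`). As `σ → 0⁺` the resolvents converge strongly (`tendsto_resOp`), hence the
sign change and the sign of the derivative survive for small `σ` (`exists_simple_root_disp`). -/

theorem re_inner_self_of_skew {S : E →L[ℂ] E} (hS : ∀ x y, ⟪S x, y⟫_ℂ = -⟪x, S y⟫_ℂ) (x : E) :
    (⟪x, S x⟫_ℂ).re = 0 := by
  have h := congrArg Complex.re (hS x x)
  rw [← inner_conj_symm (S x) x, Complex.conj_re, Complex.neg_re] at h
  linarith

/-- `-i S` is self-adjoint, so its spectrum is real and misses `i`; then `1 + S = -i (i - (-i S))`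
is invertible. -/
theorem isUnit_one_add_of_skew [CompleteSpace E] {S : E →L[ℂ] E} (hS : ∀ x y, ⟪S x, y⟫_ℂ = -⟪x, S y⟫_ℂ) :
    IsUnit (1 + S) := by
  have ha : IsSelfAdjoint ((-Complex.I) • S) := by
    rw [ContinuousLinearMap.isSelfAdjoint_iff_isSymmetric]
    intro x y
    simp [inner_smul_left, inner_smul_right, hS]
  have h : Complex.I ∉ spectrum ℂ ((-Complex.I) • S) := by
    intro h
    have := congrArg Complex.im (ha.mem_spectrum_eq_re h)
    simp at this
  rw [spectrum.notMem_iff] at h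
  have h2 : (1 + S) = (IsUnit.unit (isUnit_iff_ne_zero.2 (neg_ne_zero.2 Complex.I_ne_zero))) •
      (algebraMap ℂ (E →L[ℂ] E) Complex.I - (-Complex.I) • S) := by
    rw [Units.smul_def]
    ext x
    simp [smul_smul, Algebra.algebraMap_eq_smul_one]
  rw [h2]
  exact h.smul _

/-- The skew part contributes nothing to `Re ⟪x, x + S x⟫ = ‖x‖²`; Cauchy–Schwarz does the rest. -/
theorem norm_le_norm_one_add_of_skew {S : E →L[ℂ] E} (hS : ∀ x y, ⟪S x, y⟫_ℂ = -⟪x, S y⟫_ℂ)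
    (x : E) : ‖x‖ ≤ ‖x + S x‖ := by
  have h1 : (⟪x, x + S x⟫_ℂ).re = ‖x‖ * ‖x‖ := by
    rw [inner_add_right, Complex.add_re, re_inner_self_of_skew hS, add_zero]
    exact (inner_self_eq_norm_mul_norm (𝕜 := ℂ) x)
  have h2 : ‖x‖ * ‖x‖ ≤ ‖x‖ * ‖x + S x‖ := h1 ▸ re_inner_le_norm (𝕜 := ℂ) x (x + S x)
  rcases (norm_nonneg x).eq_or_lt with h | h
  · rw [← h]; positivity
  · exact le_of_mul_le_mul_left h2 h

/-- If `J` is symmetric and `T` is skew, the equation `v = J² (f - T v)` is uniquely solvable. -/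
theorem exists_resolvent_of_skew [CompleteSpace E] (J T : E →L[ℂ] E) (hJ : ∀ x y, ⟪J x, y⟫_ℂ = ⟪x, J y⟫_ℂ)
    (hT : ∀ x y, ⟪T x, y⟫_ℂ = -⟪x, T y⟫_ℂ) :
    ∃ R : E →L[ℂ] E, (∀ v f, v = R f ↔ v = J (J (f - T v))) ∧
      ∀ f, ‖R f‖ ≤ ‖J‖ * (‖J‖ * ‖f‖) := by
  -- Putting `v = J u` symmetrizes the equation to `(1 + J T J) u = J f`, whose operator is again a
  -- skew perturbation of the identity. Hence the witness `J (1 + J T J)⁻¹ J`.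
  have hS : ∀ x y, ⟪(J ∘L T ∘L J) x, y⟫_ℂ = -⟪x, (J ∘L T ∘L J) y⟫_ℂ := by
    intro x y
    simp [hJ, hT]
  obtain ⟨U, hU⟩ := isUnit_one_add_of_skew hS
  have hU1 : ∀ x, (↑U⁻¹ : E →L[ℂ] E) (x + J (T (J x))) = x := by
    intro x
    have h := congrArg (fun G : E →L[ℂ] E => G x) U.inv_mul
    rw [hU] at h
    exact h
  have hU2 : ∀ x, (↑U⁻¹ : E →L[ℂ] E) x + J (T (J ((↑U⁻¹ : E →L[ℂ] E) x))) = x := by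
    intro x
    have h := congrArg (fun G : E →L[ℂ] E => G x) U.mul_inv
    rw [hU] at h
    exact h
  refine ⟨J ∘L (↑U⁻¹ : E →L[ℂ] E) ∘L J, fun v f => ⟨?_, ?_⟩, fun f => ?_⟩
  · intro h
    have h2 := hU2 (J f)
    rw [show J ((↑U⁻¹ : E →L[ℂ] E) (J f)) = v from h.symm] at h2
    rw [map_sub, ← eq_sub_iff_add_eq.2 h2]
    exact h
  · intro h
    have h2 := hU1 (J (f - T v))
    rw [← h, map_sub, sub_add_cancel] at h2
    rw [map_sub, ← h2] at h
    exact h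
  · refine (J.le_opNorm _).trans ?_
    gcongr
    refine le_trans ?_ (J.le_opNorm f)
    have := norm_le_norm_one_add_of_skew hS ((↑U⁻¹ : E →L[ℂ] E) (J f))
    rwa [show (↑U⁻¹ : E →L[ℂ] E) (J f) + (J ∘L T ∘L J) ((↑U⁻¹ : E →L[ℂ] E) (J f)) = J f from
      hU2 (J f)] at this

end Skew

/-! ### Operators on `ℓ²(ℤ)` -/

/-- `ℓ²(ℤ, ℂ)`. -/
abbrev Seq : Type := lp (fun _ : ℤ => ℂ) 2

theorem summable_norm_sq (v : Seq) : Summable fun n => ‖v n‖ ^ (2 : ℝ≥0∞).toReal :=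
  (lp.memℓp v).summable (by norm_num)

/-- The diagonal operator with a bounded sequence of entries. -/
noncomputable def diagOp (d : ℤ → ℂ) (C : ℝ) (hd : ∀ n, ‖d n‖ ≤ C) : Seq →L[ℂ] Seq :=
  have hC : 0 ≤ C := (norm_nonneg _).trans (hd 0)
  have hle : ∀ (v : Seq) (n : ℤ), ‖d n * v n‖ ≤ ‖((C : ℂ) • v : Seq) n‖ := fun v n => by
    rw [norm_mul, lp.coeFn_smul, Pi.smul_apply, norm_smul, Complex.norm_real,
      Real.norm_of_nonneg hC]
    gcongr
    exact hd n
  LinearMap.mkContinuous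
    { toFun := fun v => ⟨fun n => d n * v n,
        Memℓp.mono' (lp.memℓp ((C : ℂ) • v)) (hle v)⟩
      map_add' := fun v w => by
        ext n
        exact mul_add _ _ _
      map_smul' := fun c v => by
        ext n
        simp [mul_left_comm] } C fun v => by
    have h : ‖(C : ℂ) • v‖ = C * ‖v‖ := by
      rw [norm_smul, Complex.norm_real, Real.norm_of_nonneg hC]
    rw [← h]
    exact lp.norm_mono (by norm_num) (hle v)

@[simp] theorem diagOp_apply (d : ℤ → ℂ) (C : ℝ) (hd : ∀ n, ‖d n‖ ≤ C) (v : Seq) (n : ℤ) :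
    diagOp d C hd v n = d n * v n := rfl

theorem norm_diagOp_le (d : ℤ → ℂ) (C : ℝ) (hd : ∀ n, ‖d n‖ ≤ C) : ‖diagOp d C hd‖ ≤ C := by
  unfold diagOp
  exact LinearMap.mkContinuous_norm_le _ ((norm_nonneg _).trans (hd 0)) _

/-- The shift `(v n) ↦ (v (n + k))`. -/
noncomputable def shiftOp (k : ℤ) : Seq →L[ℂ] Seq :=
  LinearMap.mkContinuous
    { toFun := fun v => ⟨fun n => v (n + k), by
        refine memℓp_gen ?_
        exact (summable_norm_sq v).comp_injective (add_left_injective k)⟩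
      map_add' := fun v w => rfl
      map_smul' := fun c v => by
        ext n
        simp } 1 fun v => by
    rw [one_mul, lp.norm_eq_tsum_rpow (by norm_num), lp.norm_eq_tsum_rpow (by norm_num)]
    refine le_of_eq ?_
    congr 1
    exact (Equiv.addRight k).tsum_eq (fun n => ‖v n‖ ^ (2 : ℝ≥0∞).toReal)

@[simp] theorem shiftOp_apply (k : ℤ) (v : Seq) (n : ℤ) : shiftOp k v n = v (n + k) := rfl

theorem inner_shiftOp (k : ℤ) (v w : Seq) : ⟪shiftOp k v, w⟫_ℂ = ⟪v, shiftOp (-k) w⟫_ℂ := by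
  rw [lp.inner_eq_tsum, lp.inner_eq_tsum,
    ← (Equiv.addRight k).tsum_eq (fun n => ⟪v n, shiftOp (-k) w n⟫_ℂ)]
  simp

theorem inner_diagOp_real (d : ℤ → ℝ) (C : ℝ) (hd : ∀ n, ‖(d n : ℂ)‖ ≤ C) (v w : Seq) :
    ⟪diagOp (fun n => (d n : ℂ)) C hd v, w⟫_ℂ = ⟪v, diagOp (fun n => (d n : ℂ)) C hd w⟫_ℂ := by
  rw [lp.inner_eq_tsum, lp.inner_eq_tsum]
  congr 1
  ext n
  simp
  ring

/-- The skew operator `(v n) ↦ (lam / 2) (v (n - 1) - v (n + 1))`. -/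
noncomputable def driftOp (lam : ℝ) : Seq →L[ℂ] Seq :=
  ((lam / 2 : ℝ) : ℂ) • (shiftOp (-1) - shiftOp 1)

@[simp] theorem driftOp_apply (lam : ℝ) (v : Seq) (n : ℤ) :
    driftOp lam v n = (lam / 2 : ℝ) * (v (n - 1) - v (n + 1)) := rfl

theorem inner_driftOp (lam : ℝ) (v w : Seq) :
    ⟪driftOp lam v, w⟫_ℂ = -⟪v, driftOp lam w⟫_ℂ := by
  simp only [driftOp, smul_apply, sub_apply,
    inner_smul_left, inner_smul_right, inner_sub_left, inner_sub_right, inner_shiftOp,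
    Complex.conj_ofReal, neg_neg]
  ring

/-- `z v + σ n² v - (drift) v = f`, coefficientwise. -/
def Solves (lam σ : ℝ) (z : ℂ) (v f : Seq) : Prop :=
  ∀ n : ℤ, (z + σ * (n : ℂ) ^ 2) * v n - driftOp lam v n = f n

/-- Splitting `Re z + σ n²` symmetrically into two inverse square roots leaves only bounded
operators, so `σ = 0` and `σ > 0` are handled together. The bound does not depend on `σ`, which is
what the limit `σ → 0` later needs. -/
theorem exists_resolvent (lam σ : ℝ) (hσ : 0 ≤ σ) (z : ℂ) (hz : 0 < z.re) :
    ∃ R : Seq →L[ℂ] Seq, (∀ v f, v = R f ↔ Solves lam σ z v f) ∧ ∀ f, ‖R f‖ ≤ ‖f‖ / z.re := by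
  have hp : ∀ n : ℤ, 0 < z.re + σ * (n : ℝ) ^ 2 := fun n => by positivity
  let d : ℤ → ℝ := fun n => (√(z.re + σ * (n : ℝ) ^ 2))⁻¹
  have hd : ∀ n, ‖(d n : ℂ)‖ ≤ (√z.re)⁻¹ := fun n => by
    rw [Complex.norm_real, Real.norm_of_nonneg (by positivity)]
    refine inv_anti₀ (Real.sqrt_pos.2 hz) (Real.sqrt_le_sqrt ?_)
    have : 0 ≤ σ * (n : ℝ) ^ 2 := by positivity
    linarith
  have hdd : ∀ n, (d n : ℂ) * d n * (z.re + σ * (n : ℂ) ^ 2) = 1 := fun n => by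
    have h : d n * d n * (z.re + σ * (n : ℝ) ^ 2) = 1 := by
      rw [← mul_inv, Real.mul_self_sqrt (hp n).le, inv_mul_cancel₀ (hp n).ne']
    exact_mod_cast congrArg (fun r : ℝ => (r : ℂ)) h
  set J := diagOp (fun n => (d n : ℂ)) _ hd with hJ
  -- `T` collects the skew terms: the imaginary part of `z` and the drift.
  let T : Seq →L[ℂ] Seq := ((z.im : ℂ) * Complex.I) • ContinuousLinearMap.id ℂ Seq - driftOp lam
  obtain ⟨R, hR, hR'⟩ := exists_resolvent_of_skew J T (inner_diagOp_real d _ hd) (fun v w => by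
    simp only [T, smul_apply, sub_apply,
      ContinuousLinearMap.id_apply,
      inner_smul_left, inner_smul_right, inner_sub_left, inner_sub_right, inner_driftOp]
    simp
    ring)
  refine ⟨R, fun v f => (hR v f).trans ?_, fun f => (hR' f).trans ?_⟩
  · rw [lp.ext_iff, funext_iff]
    refine forall_congr' fun n => ?_
    have e : J (J (f - T v)) n = (d n : ℂ) * d n * (f n - (z.im * Complex.I * v n - driftOp lam v n)) := by
      have e2 : (f - T v : Seq) n = f n - (z.im * Complex.I * v n - driftOp lam v n) := rfl
      rw [hJ, diagOp_apply, diagOp_apply, e2]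
      ring
    rw [e]
    have h0 : (d n : ℂ) * d n ≠ 0 := left_ne_zero_of_mul_eq_one (hdd n)
    have hz' : (z.re : ℂ) = z - z.im * Complex.I := eq_sub_of_add_eq (Complex.re_add_im z)
    have hn := hdd n
    rw [hz'] at hn
    constructor
    · intro h
      refine mul_left_cancel₀ h0 ?_
      linear_combination h + v n * hn
    · intro h
      rw [← h]
      linear_combination (-v n) * hn
  · have h := norm_diagOp_le (fun n => (d n : ℂ)) _ hd
    calc ‖J‖ * (‖J‖ * ‖f‖) ≤ (√z.re)⁻¹ * ((√z.re)⁻¹ * ‖f‖) := by gcongr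
      _ = ‖f‖ / z.re := by
        rw [← mul_assoc, ← mul_inv, Real.mul_self_sqrt hz.le, div_eq_inv_mul]

open scoped Classical in
/-- The resolvent `(z - A)⁻¹` for `0 < re z`, where `A v n = -σ n² v n + (drift) v n`. -/
noncomputable def resOp (lam σ : ℝ) (z : ℂ) : Seq →L[ℂ] Seq :=
  if h : 0 ≤ σ ∧ 0 < z.re then (exists_resolvent lam σ h.1 z h.2).choose else 0

theorem eq_resOp_iff {lam σ : ℝ} (hσ : 0 ≤ σ) {z : ℂ} (hz : 0 < z.re) {v f : Seq} :
    v = resOp lam σ z f ↔ Solves lam σ z v f := by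
  rw [resOp, dif_pos ⟨hσ, hz⟩]
  exact (exists_resolvent lam σ hσ z hz).choose_spec.1 v f

theorem norm_resOp_le {lam σ : ℝ} (hσ : 0 ≤ σ) {z : ℂ} (hz : 0 < z.re) (f : Seq) :
    ‖resOp lam σ z f‖ ≤ ‖f‖ / z.re := by
  rw [resOp, dif_pos ⟨hσ, hz⟩]
  exact (exists_resolvent lam σ hσ z hz).choose_spec.2 f

theorem solves_resOp {lam σ : ℝ} (hσ : 0 ≤ σ) {z : ℂ} (hz : 0 < z.re) (f : Seq) :
    Solves lam σ z (resOp lam σ z f) f :=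
  (eq_resOp_iff hσ hz).1 rfl

/-- The resolvent identity, obtained from uniqueness of solutions; it is the source of both
continuity and differentiability in `z`. -/
theorem resOp_sub_resOp {lam σ : ℝ} (hσ : 0 ≤ σ) {z w : ℂ} (hz : 0 < z.re) (hw : 0 < w.re)
    (f : Seq) : resOp lam σ z f - resOp lam σ w f =
      (w - z) • resOp lam σ z (resOp lam σ w f) := by
  rw [sub_eq_iff_eq_add, ← map_smul, eq_comm]
  have h : resOp lam σ w f = resOp lam σ z (f - (w - z) • resOp lam σ w f) := by
    rw [eq_resOp_iff hσ hz]
    intro n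
    have := solves_resOp (lam := lam) hσ hw f n
    simp only [lp.coeFn_sub, lp.coeFn_smul, Pi.sub_apply, Pi.smul_apply, smul_eq_mul]
    linear_combination this
  nth_rewrite 2 [h]
  rw [← map_add, add_sub_cancel]

/-! ### Continuity, derivative and reality of the resolvent -/

theorem norm_resOp_sub_resOp_le {lam σ : ℝ} (hσ : 0 ≤ σ) {z w : ℂ} (hz : 0 < z.re) (hw : 0 < w.re)
    (f : Seq) : ‖resOp lam σ z f - resOp lam σ w f‖ ≤ ‖w - z‖ * (‖f‖ / w.re / z.re) := by
  rw [resOp_sub_resOp hσ hz hw, norm_smul]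
  gcongr
  refine (norm_resOp_le hσ hz _).trans ?_
  gcongr
  exact norm_resOp_le hσ hw f

theorem eventually_re_pos {z : ℂ} (hz : 0 < z.re) : ∀ᶠ w in 𝓝 z, 0 < w.re :=
  Complex.continuous_re.continuousAt.eventually_const_lt hz

theorem continuousAt_resOp {lam σ : ℝ} (hσ : 0 ≤ σ) {z : ℂ} (hz : 0 < z.re) (f : Seq) :
    ContinuousAt (fun w => resOp lam σ w f) z := by
  rw [ContinuousAt, tendsto_iff_norm_sub_tendsto_zero]
  have h : Tendsto (fun w : ℂ => ‖z - w‖ * (‖f‖ / z.re / w.re)) (𝓝 z)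
      (𝓝 (‖z - z‖ * (‖f‖ / z.re / z.re))) := by
    have h1 : Tendsto (fun w : ℂ => w.re) (𝓝 z) (𝓝 z.re) := Complex.continuous_re.continuousAt
    exact (tendsto_const_nhds.sub tendsto_id).norm.mul (tendsto_const_nhds.div h1 hz.ne')
  rw [sub_self, norm_zero, zero_mul] at h
  refine squeeze_zero' (Eventually.of_forall fun _ => norm_nonneg _) ?_ h
  filter_upwards [eventually_re_pos hz] with w hw
  exact norm_resOp_sub_resOp_le hσ hw hz f

theorem continuous_coord (n : ℤ) : Continuous fun v : Seq => v n :=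
  (lp.evalCLM ℂ (fun _ : ℤ => ℂ) 2 n).continuous

/-- By the resolvent identity the difference quotient is exactly `-(R(w) R(z) f)ₙ`, so strong
continuity in `w` is enough. -/
theorem hasDerivAt_resOp_coord {lam σ : ℝ} (hσ : 0 ≤ σ) {z : ℂ} (hz : 0 < z.re) (f : Seq) (n : ℤ) :
    HasDerivAt (fun w => resOp lam σ w f n) (-resOp lam σ z (resOp lam σ z f) n) z := by
  rw [hasDerivAt_iff_tendsto_slope]
  have h1 : Tendsto (fun w => -resOp lam σ w (resOp lam σ z f) n) (𝓝[≠] z)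
      (𝓝 (-resOp lam σ z (resOp lam σ z f) n)) :=
    (((continuous_coord n).continuousAt.comp
      (continuousAt_resOp hσ hz (resOp lam σ z f))).neg).tendsto.mono_left nhdsWithin_le_nhds
  refine h1.congr' ?_
  filter_upwards [nhdsWithin_le_nhds (eventually_re_pos hz), self_mem_nhdsWithin] with w hw hne
  have h := congrArg (fun v : Seq => v n) (resOp_sub_resOp (lam := lam) hσ hw hz f)
  simp only [lp.coeFn_sub, Pi.sub_apply, lp.coeFn_smul, Pi.smul_apply, smul_eq_mul] at h
  have hne' : w - z ≠ 0 := sub_ne_zero.2 hne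
  rw [slope_def_field, h]
  field_simp
  ring

/-- For real `x` the equation has real coefficients, so conjugation maps solutions to solutions and
uniqueness applies. -/
theorem star_resOp {lam σ : ℝ} (hσ : 0 ≤ σ) {x : ℝ} (hx : 0 < x) (f : Seq) :
    star (resOp lam σ x f) = resOp lam σ x (star f) := by
  have hx' : 0 < (x : ℂ).re := by simpa
  rw [eq_resOp_iff hσ hx']
  intro n
  have h := congrArg star (solves_resOp (lam := lam) hσ hx' f n)
  simpa [driftOp_apply] using h

theorem resOp_ofReal_coord_im {lam σ : ℝ} (hσ : 0 ≤ σ) {x : ℝ} (hx : 0 < x) {f : Seq}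
    (hf : star f = f) (n : ℤ) : (resOp lam σ x f n).im = 0 := by
  have h := congrArg (fun v : Seq => v n) (star_resOp (lam := lam) hσ hx f)
  rw [hf] at h
  exact Complex.conj_eq_iff_im.1 h

/-! ### The limit of small diffusion -/

/-- A unit mode lies in the domain of the diffusion: it solves the `σ`-equation up to the error `σ
n² v`, which the uniform resolvent bound sends to zero. -/
theorem tendsto_resOp_diffusion_single {lam x : ℝ} (hx : 0 < x) (n : ℤ) (a : ℂ) :
    Tendsto (fun σ : ℝ => resOp lam σ x ((x : ℂ) • lp.single 2 n a - driftOp lam (lp.single 2 n a)))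
      (𝓝[≥] 0) (𝓝 (lp.single 2 n a)) := by
  have hx' : 0 < (x : ℂ).re := by simpa
  set v : Seq := lp.single 2 n a
  have h0 : Tendsto (fun σ : ℝ => ‖((σ : ℂ) * (n : ℂ) ^ 2) • v‖ / (x : ℂ).re) (𝓝[≥] 0) (𝓝 0) := by
    have : Continuous fun σ : ℝ => ‖((σ : ℂ) * (n : ℂ) ^ 2) • v‖ / (x : ℂ).re := by fun_prop
    simpa using (this.tendsto 0).mono_left nhdsWithin_le_nhds
  rw [tendsto_iff_norm_sub_tendsto_zero]
  refine squeeze_zero' (Eventually.of_forall fun _ => norm_nonneg _) ?_ h0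
  filter_upwards [self_mem_nhdsWithin] with σ hσ
  have hσ : 0 ≤ σ := hσ
  have e : v = resOp lam σ x ((x : ℂ) • v - driftOp lam v + ((σ : ℂ) * (n : ℂ) ^ 2) • v) := by
    rw [eq_resOp_iff hσ hx']
    intro m
    simp only [lp.coeFn_add, lp.coeFn_sub, lp.coeFn_smul, Pi.add_apply, Pi.sub_apply, Pi.smul_apply,
      smul_eq_mul]
    rcases eq_or_ne m n with rfl | hne
    · ring
    · rw [show v m = 0 from lp.single_apply_ne (E := fun _ : ℤ => ℂ) 2 n a hne]
      ring
  nth_rewrite 3 [e]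
  rw [map_add, sub_add_cancel_left, norm_neg]
  exact norm_resOp_le hσ hx' _

/-- Only strong convergence holds in general, since `σ n²` is unbounded in `n`. It is checked on
finite combinations of modes and extended by density and the uniform bound. -/
theorem tendsto_resOp_diffusion {lam x : ℝ} (hx : 0 < x) (f : Seq) :
    Tendsto (fun σ : ℝ => resOp lam σ x f) (𝓝[≥] 0) (𝓝 (resOp lam 0 x f)) := by
  have hx' : 0 < (x : ℂ).re := by simpa
  let B : Seq →L[ℂ] Seq := (x : ℂ) • ContinuousLinearMap.id ℂ Seq - driftOp lam
  have hf : f = B (resOp lam 0 x f) := by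
    ext n
    have := solves_resOp (lam := lam) le_rfl hx' f n
    rw [← this, Complex.ofReal_zero, zero_mul, add_zero]
    rfl
  set v := resOp lam 0 x f with hv
  have hfin : ∀ s : Finset ℤ, Tendsto (fun σ : ℝ => resOp lam σ x (B (∑ n ∈ s, lp.single 2 n (v n))))
      (𝓝[≥] 0) (𝓝 (∑ n ∈ s, lp.single 2 n (v n))) := by
    intro s
    simp only [map_sum]
    exact tendsto_finsetSum _ fun n _ => tendsto_resOp_diffusion_single hx n (v n)
  rw [Metric.tendsto_nhds]
  intro ε hε
  -- Replacing `v` by its truncation `w` costs `‖w - v‖` directly and `‖B‖ / x * ‖w - v‖` through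
  -- the resolvent; this constant is their total factor.
  have hC : 0 < ‖B‖ / x + 1 := by positivity
  have hsum := lp.hasSum_single (p := 2) (by norm_num) v
  obtain ⟨s, hs⟩ := ((Metric.tendsto_nhds.1 hsum) (ε / 2 / (‖B‖ / x + 1)) (by positivity)).exists
  filter_upwards [(Metric.tendsto_nhds.1 (hfin s)) (ε / 2) (by positivity), self_mem_nhdsWithin]
    with σ h1 hσ
  set w := ∑ n ∈ s, lp.single 2 n (v n) with hw
  rw [dist_eq_norm] at hs h1 ⊢
  have e : resOp lam σ x f - v =
      -resOp lam σ x (B (w - v)) + (resOp lam σ x (B w) - w) + (w - v) := by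
    rw [map_sub, map_sub, ← hf]
    abel
  have h2 : ‖resOp lam σ x (B (w - v))‖ ≤ ‖B‖ / x * ‖w - v‖ := by
    refine (norm_resOp_le hσ hx' _).trans ?_
    rw [Complex.ofReal_re, div_mul_eq_mul_div]
    gcongr
    exact B.le_opNorm _
  rw [lt_div_iff₀ hC] at hs
  rw [e]
  have h3 := norm_add_le (-resOp lam σ x (B (w - v)) + (resOp lam σ x (B w) - w)) (w - v)
  have h4 := norm_add_le (-resOp lam σ x (B (w - v))) (resOp lam σ x (B w) - w)
  rw [norm_neg] at h4
  linarith

theorem tendsto_resOp {ι : Type*} {l : Filter ι} {lam x₀ : ℝ} (hx₀ : 0 < x₀) {σ x : ι → ℝ}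
    {f : ι → Seq} {f₀ : Seq} (hσ : Tendsto σ l (𝓝[≥] 0)) (hx : Tendsto x l (𝓝 x₀))
    (hf : Tendsto f l (𝓝 f₀)) :
    Tendsto (fun i => resOp lam (σ i) (x i) (f i)) l (𝓝 (resOp lam 0 x₀ f₀)) := by
  have hσ0 : ∀ᶠ i in l, 0 ≤ σ i := hσ.eventually self_mem_nhdsWithin
  have hx0 : ∀ᶠ i in l, 0 < x i := hx.eventually_const_lt hx₀
  have h1 : Tendsto (fun i => resOp lam (σ i) (x i) (f i - f₀)) l (𝓝 0) := by
    have h : Tendsto (fun i => ‖f i - f₀‖ / x i) l (𝓝 (‖f₀ - f₀‖ / x₀)) :=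
      (hf.sub_const f₀).norm.div hx hx₀.ne'
    rw [sub_self, norm_zero, zero_div] at h
    refine squeeze_zero_norm' ?_ h
    filter_upwards [hσ0, hx0] with i hi hi'
    exact norm_resOp_le hi (z := (x i : ℂ)) (by simpa) _
  have h2 : Tendsto (fun i => resOp lam (σ i) (x i) f₀ - resOp lam (σ i) x₀ f₀) l (𝓝 0) := by
    have h : Tendsto (fun i => ‖(x₀ : ℂ) - x i‖ * (‖f₀‖ / x₀ / x i)) l
        (𝓝 (‖(x₀ : ℂ) - x₀‖ * (‖f₀‖ / x₀ / x₀))) :=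
      (tendsto_const_nhds.sub ((Complex.continuous_ofReal.tendsto x₀).comp hx)).norm.mul
        (tendsto_const_nhds.div hx hx₀.ne')
    rw [sub_self, norm_zero, zero_mul] at h
    refine squeeze_zero_norm' ?_ h
    filter_upwards [hσ0, hx0] with i hi hi'
    exact norm_resOp_sub_resOp_le hi (z := (x i : ℂ)) (w := (x₀ : ℂ)) (by simpa) (by simpa) f₀
  have h3 := (h1.add h2).add ((tendsto_resOp_diffusion (lam := lam) hx₀ f₀).comp hσ)
  rw [zero_add, zero_add] at h3
  refine h3.congr fun i => ?_
  simp only [map_sub, Function.comp_apply]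
  abel

/-! ### The dispersion function -/

/-- The source sequence: `-tau` at `±2`, and `±1` at `±1`. -/
noncomputable def source (tau : ℝ) : Seq :=
  lp.single 2 1 1 - lp.single 2 (-1) 1 - (tau : ℂ) • (lp.single 2 2 1 + lp.single 2 (-2) 1)

theorem single_apply_eq_ite (k n : ℤ) :
    (lp.single 2 k (1 : ℂ) : Seq) n = if n = k then 1 else 0 := by
  rw [lp.single_apply]
  exact Pi.single_apply k (1 : ℂ) n

theorem source_apply (tau : ℝ) (n : ℤ) :
    source tau n = ((if n = 1 then 1 else 0) - (if n = -1 then 1 else 0) -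
      tau * ((if n = 2 then 1 else 0) + (if n = -2 then 1 else 0)) : ℂ) := by
  simp only [source, lp.coeFn_sub, lp.coeFn_smul, lp.coeFn_add, Pi.sub_apply, Pi.smul_apply,
    Pi.add_apply, single_apply_eq_ite, smul_eq_mul]

theorem star_source (tau : ℝ) : star (source tau) = source tau := by
  ext n
  rw [lp.star_apply, source_apply]
  simp only [star_sub, star_mul', star_add, apply_ite (star : ℂ → ℂ), star_one, star_zero]
  simp

/-- The dispersion function, whose zeros in the right half plane are the eigenvalues. -/
noncomputable def disp (chi tau lam σ : ℝ) (z : ℂ) : ℂ :=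
  1 + (Real.pi * chi : ℝ) * resOp lam σ z (source tau) 0

/-- The derivative of the dispersion function. -/
noncomputable def dispDeriv (chi tau lam σ : ℝ) (z : ℂ) : ℂ :=
  (Real.pi * chi : ℝ) * -resOp lam σ z (resOp lam σ z (source tau)) 0

theorem hasDerivAt_disp (chi tau lam : ℝ) {σ : ℝ} (hσ : 0 ≤ σ) {z : ℂ} (hz : 0 < z.re) :
    HasDerivAt (disp chi tau lam σ) (dispDeriv chi tau lam σ z) z :=
  ((hasDerivAt_resOp_coord hσ hz (source tau) 0).const_mul _).const_add 1

theorem hasDerivAt_disp_re (chi tau lam : ℝ) {σ : ℝ} (hσ : 0 ≤ σ) {x : ℝ} (hx : 0 < x) :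
    HasDerivAt (fun y : ℝ => (disp chi tau lam σ y).re) (dispDeriv chi tau lam σ x).re x :=
  (hasDerivAt_disp chi tau lam hσ (z := (x : ℂ)) (by simpa)).real_of_complex

theorem disp_im (chi tau lam : ℝ) {σ : ℝ} (hσ : 0 ≤ σ) {x : ℝ} (hx : 0 < x) :
    (disp chi tau lam σ x).im = 0 := by
  rw [disp, Complex.add_im, Complex.im_ofReal_mul,
    resOp_ofReal_coord_im hσ hx (star_source tau)]
  simp

/-- The solution of the adjoint equation with right-hand side the unit vector at `0`. -/
theorem exists_adjoint_solution {lam q : ℝ} (hlam : 0 < lam) (hq0 : 0 < q) (hq1 : q < 1) :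
    ∃ h : Seq, (∀ n : ℤ, ((lam * (1 / q - q) / 2 : ℝ) : ℂ) * h n + driftOp lam h n =
        (lp.single 2 0 (1 : ℂ) : Seq) n) ∧
      h 1 = (-(2 * q ^ 2 / (lam * (1 + q ^ 2))) : ℝ) ∧
      h (-1) = ((2 * q ^ 2 / (lam * (1 + q ^ 2))) : ℝ) ∧
      h 2 = ((2 * q ^ 3 / (lam * (1 + q ^ 2))) : ℝ) ∧
      h (-2) = ((2 * q ^ 3 / (lam * (1 + q ^ 2))) : ℝ) := by
  -- The homogeneous recurrence has characteristic roots `-q` and `1/q`. Square summability selects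
  -- the first for `n ≥ 0` and the second for `n ≤ 0`; `c` is fixed by the equation at `n = 0`.
  let c : ℝ := 2 * q / (lam * (1 + q ^ 2))
  let g : ℤ → ℝ := fun n => if 0 ≤ n then c * (-q) ^ n.natAbs else c * q ^ n.natAbs
  have hg0 : ∀ m : ℕ, g m = c * (-q) ^ m := fun m => by simp [g]
  have hg1 : ∀ m : ℕ, g (-m) = c * q ^ m := fun m => by
    rcases Nat.eq_zero_or_pos m with rfl | hm
    · simp [g]
    · simp only [g, Int.natAbs_neg, Int.natAbs_natCast]
      rw [if_neg (by omega)]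
  have hsum : Summable fun n : ℤ => ‖(g n : ℂ)‖ := by
    have hs : Summable fun m : ℕ => |c| * q ^ m :=
      (summable_geometric_of_lt_one hq0.le hq1).mul_left _
    refine Summable.of_nat_of_neg ?_ ?_
    · refine hs.congr fun m => ?_
      rw [hg0, Complex.norm_real, norm_mul, norm_pow, norm_neg, Real.norm_eq_abs, Real.norm_eq_abs,
        abs_of_pos hq0]
    · refine hs.congr fun m => ?_
      rw [hg1, Complex.norm_real, norm_mul, norm_pow, Real.norm_eq_abs, Real.norm_eq_abs,
        abs_of_pos hq0]
  have hmem : Memℓp (fun n : ℤ => (g n : ℂ)) 2 :=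
    Memℓp.of_exponent_ge (q := 1) (memℓp_gen (by simpa using hsum)) (by norm_num)
  have hlam' := hlam.ne'
  have hq' := hq0.ne'
  have h1q : 1 + q ^ 2 ≠ 0 := by positivity
  refine ⟨⟨_, hmem⟩, fun n => ?_, ?_, ?_, ?_, ?_⟩
  · change ((lam * (1 / q - q) / 2 : ℝ) : ℂ) * (g n : ℂ) + (lam / 2 : ℝ) * ((g (n - 1) : ℂ) - g (n + 1)) =
      (lp.single 2 0 (1 : ℂ) : Seq) n
    rw [single_apply_eq_ite]
    have key : lam * (1 / q - q) / 2 * g n + lam / 2 * (g (n - 1) - g (n + 1)) =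
        if n = 0 then 1 else 0 := by
      obtain ⟨m, rfl | rfl⟩ := n.eq_nat_or_neg
      · rcases m with _ | m
        · have e1 := hg0 1
          have e2 := hg1 1
          have e0 := hg0 0
          norm_num at e1 e2 e0 ⊢
          rw [e1, e2, e0]
          simp only [c]
          field_simp
          ring
        · rw [if_neg (by omega), show ((m + 1 : ℕ) : ℤ) - 1 = (m : ℕ) by push_cast; ring,
            show ((m + 1 : ℕ) : ℤ) + 1 = (m + 2 : ℕ) by push_cast; ring, hg0, hg0, hg0]
          field_simp
          ring
      · rcases m with _ | m
        · have e1 := hg0 1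
          have e2 := hg1 1
          have e0 := hg0 0
          norm_num at e1 e2 e0 ⊢
          rw [e1, e2, e0]
          simp only [c]
          field_simp
          ring
        · rw [if_neg (by omega), show -((m + 1 : ℕ) : ℤ) - 1 = -(m + 2 : ℕ) by push_cast; ring,
            show -((m + 1 : ℕ) : ℤ) + 1 = -(m : ℕ) by push_cast; ring, hg1, hg1, hg1]
          field_simp
          ring
    have key' := congrArg (fun r : ℝ => (r : ℂ)) key
    simp only [apply_ite (fun r : ℝ => (r : ℂ))] at key'
    push_cast at key' ⊢
    exact key'
  · change (g (1 : ℕ) : ℂ) = _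
    rw [hg0]
    congr 1
    simp only [c]
    ring
  · change (g (-(1 : ℕ)) : ℂ) = _
    rw [hg1]
    congr 1
    simp only [c]
    ring
  · change (g (2 : ℕ) : ℂ) = _
    rw [hg0]
    congr 1
    simp only [c]
    ring
  · change (g (-(2 : ℕ)) : ℂ) = _
    rw [hg1]
    congr 1
    simp only [c]
    ring

theorem inner_source (h : Seq) (tau : ℝ) :
    ⟪h, source tau⟫_ℂ = conj (h 1) - conj (h (-1)) - tau * (conj (h 2) + conj (h (-2))) := by
  simp only [source, inner_sub_right, inner_smul_right, inner_add_right, lp.inner_single_right]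
  simp

/-- The dispersion function without diffusion, in the variable `q`, where
`x = lam (1 / q - q) / 2`. -/
theorem disp_zero_eq (chi tau : ℝ) {lam q : ℝ} (hlam : 0 < lam) (hq0 : 0 < q) (hq1 : q < 1) :
    disp chi tau lam 0 ((lam * (1 / q - q) / 2 : ℝ) : ℂ) =
      ((1 - 4 * Real.pi * chi / lam * ((tau * q ^ 3 + q ^ 2) / (1 + q ^ 2)) : ℝ) : ℂ) := by
  set x : ℝ := lam * (1 / q - q) / 2 with hx
  have hx0 : 0 < x := by
    have : q < 1 / q := by
      rw [lt_div_iff₀ hq0]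
      nlinarith
    have : 0 < 1 / q - q := by linarith
    positivity
  obtain ⟨h, hh, h1, h1', h2, h2'⟩ := exists_adjoint_solution hlam hq0 hq1
  set v := resOp lam 0 x (source tau) with hv
  have e1 : source tau = (x : ℂ) • v - driftOp lam v := by
    ext n
    rw [← solves_resOp (lam := lam) le_rfl (z := (x : ℂ)) (by simpa) (source tau) n,
      Complex.ofReal_zero, zero_mul, add_zero]
    rfl
  have e2 : (x : ℂ) • h + driftOp lam h = lp.single 2 0 (1 : ℂ) := by
    ext n
    exact hh n
  -- Skewness moves the drift across the inner product: `v₀ = ⟪(x + drift) h, v⟫ = ⟪h, (x - drift)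
  -- v⟫`. Only the four entries of `h` on the support of the source are then needed.
  have e3 : ⟪h, source tau⟫_ℂ = v 0 := by
    have : v 0 = ⟪(lp.single 2 0 (1 : ℂ) : Seq), v⟫_ℂ := by
      rw [lp.inner_single_left]
      simp
    rw [this, ← e2, e1, inner_sub_right, inner_smul_right, inner_add_left, inner_smul_left,
      inner_driftOp, Complex.conj_ofReal]
    ring
  rw [disp, ← hv, ← e3, inner_source, h1, h1', h2, h2']
  simp only [Complex.conj_ofReal]
  norm_cast
  have h1q : 1 + q ^ 2 ≠ 0 := by positivity
  field_simp
  ring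

/-! ### A simple real zero of the dispersion function -/

/-- The function is `1` at `q = 0` and `1 - κ (tau + 1) / 2 < 0` at `q = 1`. -/
theorem exists_root_profile {κ tau : ℝ} (hκ : 2 < κ * (tau + 1)) :
    ∃ q : ℝ, 0 < q ∧ q < 1 ∧ 1 - κ * ((tau * q ^ 3 + q ^ 2) / (1 + q ^ 2)) = 0 := by
  have hc : ContinuousOn (fun q : ℝ => 1 - κ * ((tau * q ^ 3 + q ^ 2) / (1 + q ^ 2)))
      (Set.Icc 0 1) := by
    refine Continuous.continuousOn ?_
    refine continuous_const.sub (continuous_const.mul (Continuous.div (by fun_prop) (by fun_prop) ?_))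
    intro q
    positivity
  have h := intermediate_value_Icc' zero_le_one hc
  obtain ⟨q, hq, h0⟩ := h (show (0 : ℝ) ∈ Set.Icc _ _ by
    constructor <;> norm_num
    linarith)
  refine ⟨q, lt_of_le_of_ne hq.1 ?_, lt_of_le_of_ne hq.2 ?_, h0⟩
  · rintro rfl
    norm_num at h0
  · rintro rfl
    norm_num at h0
    linarith

theorem hasDerivAt_profile (κ tau q : ℝ) :
    HasDerivAt (fun q : ℝ => 1 - κ * ((tau * q ^ 3 + q ^ 2) / (1 + q ^ 2)))
      (-(κ * ((3 * tau * q ^ 2 + tau * q ^ 4 + 2 * q) / (1 + q ^ 2) ^ 2))) q := by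
  have h1 : HasDerivAt (fun q : ℝ => tau * q ^ 3 + q ^ 2) (tau * (3 * q ^ 2) + 2 * q) q := by
    simpa using ((hasDerivAt_pow 3 q).const_mul tau).fun_add (hasDerivAt_pow 2 q)
  have h2 : HasDerivAt (fun q : ℝ => 1 + q ^ 2) (2 * q) q := by
    simpa using (hasDerivAt_pow 2 q).const_add 1
  have h := ((h1.div h2 (by positivity)).const_mul κ).const_sub 1
  refine h.congr_deriv ?_
  congr 3
  ring

theorem hasDerivAt_param (lam : ℝ) {q : ℝ} (hq : q ≠ 0) :
    HasDerivAt (fun q : ℝ => lam * (1 / q - q) / 2) (lam * (-(q ^ 2)⁻¹ - 1) / 2) q := by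
  have h : HasDerivAt (fun q : ℝ => 1 / q - q) (-(q ^ 2)⁻¹ - 1) q := by
    simpa using (hasDerivAt_inv hq).fun_sub (hasDerivAt_id' q)
  exact (h.const_mul lam).div_const 2

theorem param_pos {lam q : ℝ} (hlam : 0 < lam) (hq0 : 0 < q) (hq1 : q < 1) :
    0 < lam * (1 / q - q) / 2 := by
  have : q < 1 / q := by
    rw [lt_div_iff₀ hq0]
    nlinarith
  have : 0 < 1 / q - q := by linarith
  positivity

/-- Without diffusion the dispersion function has a real positive zero with positive derivative. -/
theorem exists_root_disp_zero {chi tau lam : ℝ} (hchi : 0 < chi) (htau : 0 < tau) (hlam : 0 < lam)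
    (hcond : lam < 2 * Real.pi * chi * (tau + 1)) :
    ∃ x : ℝ, 0 < x ∧ (disp chi tau lam 0 x).re = 0 ∧ 0 < (dispDeriv chi tau lam 0 x).re := by
  have hπ := Real.pi_pos
  set κ := 4 * Real.pi * chi / lam with hκ
  have hκ0 : 0 < κ := by positivity
  obtain ⟨q, hq0, hq1, hq⟩ := exists_root_profile (κ := κ) (tau := tau) (by
    rw [hκ, div_mul_eq_mul_div, lt_div_iff₀ hlam]
    linarith)
  have hx := param_pos hlam hq0 hq1
  refine ⟨_, hx, ?_, ?_⟩
  · rw [disp_zero_eq chi tau hlam hq0 hq1, Complex.ofReal_re]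
    exact hq
  · have h1 := (hasDerivAt_disp_re chi tau lam le_rfl hx).comp q (hasDerivAt_param lam hq0.ne')
    have h2 : HasDerivAt ((fun y : ℝ => (disp chi tau lam 0 y).re) ∘
        fun q : ℝ => lam * (1 / q - q) / 2)
        (-(κ * ((3 * tau * q ^ 2 + tau * q ^ 4 + 2 * q) / (1 + q ^ 2) ^ 2))) q := by
      refine (hasDerivAt_profile κ tau q).congr_of_eventuallyEq ?_
      filter_upwards [Ioo_mem_nhds hq0 hq1] with p hp
      simp only [Function.comp_apply]
      rw [disp_zero_eq chi tau hlam hp.1 hp.2, Complex.ofReal_re]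
    -- The chain rule in `q`: the derivative of `D` times `dx/dq` is negative. As `dx/dq ≤ 0`, a
    -- nonpositive derivative of `D` would contradict this.
    have h3 := h1.unique h2
    by_contra! hneg
    have h4 : lam * (-(q ^ 2)⁻¹ - 1) / 2 ≤ 0 := by
      have : 0 < lam * (q ^ 2)⁻¹ := by positivity
      linarith
    have h5 := mul_nonneg_of_nonpos_of_nonpos hneg h4
    rw [h3] at h5
    have h6 : 0 < κ * ((3 * tau * q ^ 2 + tau * q ^ 4 + 2 * q) / (1 + q ^ 2) ^ 2) := by positivity
    linarith

/-! ### Persistence of the zero for small diffusion -/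

theorem tendsto_dispDeriv_re (chi tau lam : ℝ) {x₀ : ℝ} (hx₀ : 0 < x₀) :
    Tendsto (fun p : ℝ × ℝ => (dispDeriv chi tau lam p.1 p.2).re) (𝓝[≥] 0 ×ˢ 𝓝 x₀)
      (𝓝 (dispDeriv chi tau lam 0 x₀).re) := by
  have h1 := tendsto_resOp (lam := lam) hx₀ tendsto_fst tendsto_snd
    (tendsto_const_nhds (x := source tau) (f := 𝓝[≥] (0 : ℝ) ×ˢ 𝓝 x₀))
  have h2 := tendsto_resOp (lam := lam) hx₀ tendsto_fst tendsto_snd h1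
  exact (Complex.continuous_re.tendsto _).comp
    ((((continuous_coord 0).tendsto _).comp h2).neg.const_mul _)

theorem tendsto_disp_re (chi tau lam : ℝ) {x : ℝ} (hx : 0 < x) :
    Tendsto (fun σ : ℝ => (disp chi tau lam σ x).re) (𝓝[≥] 0) (𝓝 (disp chi tau lam 0 x).re) :=
  (Complex.continuous_re.tendsto _).comp
    (((((continuous_coord 0).tendsto _).comp
      (tendsto_resOp_diffusion (lam := lam) hx (source tau))).const_mul _).const_add 1)

/-- For small diffusion the dispersion function has a simple real positive zero. -/
theorem exists_simple_root_disp {chi tau lam : ℝ} (hchi : 0 < chi) (htau : 0 < tau) (hlam : 0 < lam)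
    (hcond : lam < 2 * Real.pi * chi * (tau + 1)) :
    ∃ σstar : ℝ, 0 < σstar ∧ ∀ σ : ℝ, 0 ≤ σ → σ < σstar →
      ∃ μ : ℝ, 0 < μ ∧ disp chi tau lam σ μ = 0 ∧ dispDeriv chi tau lam σ μ ≠ 0 := by
  obtain ⟨x₀, hx₀, h0, hd0⟩ := exists_root_disp_zero hchi htau hlam hcond
  have hev := (tendsto_dispDeriv_re chi tau lam hx₀).eventually_const_lt hd0
  obtain ⟨pa, ha, pb, hb, hab⟩ := Filter.eventually_prod_iff.1 hev
  obtain ⟨δ, hδ, hδb⟩ := Metric.eventually_nhds_iff.1 hb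
  -- `r < δ` keeps the interval where the derivative is positive, and `r < x₀` keeps it in the right
  -- half line.
  obtain ⟨r, hr0, hr⟩ := exists_between (lt_min hδ hx₀)
  obtain ⟨hrδ, hrx⟩ := lt_min_iff.1 hr
  have hI : ∀ x ∈ Set.Icc (x₀ - r) (x₀ + r), 0 < x ∧ pb x := fun x hx => by
    refine ⟨by linarith [hx.1], hδb ?_⟩
    rw [Real.dist_eq]
    exact (abs_le.2 ⟨by linarith [hx.1], by linarith [hx.2]⟩).trans_lt hrδ
  have hcont : ∀ σ : ℝ, 0 ≤ σ → ContinuousOn (fun y : ℝ => (disp chi tau lam σ y).re)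
      (Set.Icc (x₀ - r) (x₀ + r)) := fun σ hσ x hx =>
    (hasDerivAt_disp_re chi tau lam hσ (hI x hx).1).continuousAt.continuousWithinAt
  have hmono : StrictMonoOn (fun y : ℝ => (disp chi tau lam 0 y).re)
      (Set.Icc (x₀ - r) (x₀ + r)) := by
    refine strictMonoOn_of_deriv_pos (convex_Icc _ _) (hcont 0 le_rfl) fun x hx => ?_
    obtain ⟨hx0, hxb⟩ := hI x (interior_subset hx)
    rw [(hasDerivAt_disp_re chi tau lam le_rfl hx0).deriv]
    -- The one-sided neighbourhood `𝓝[≥] 0` contains `0` itself, so the derivative bound also covers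
    -- `σ = 0`.
    exact hab (ha.self_of_nhdsWithin (Set.mem_Ici.2 le_rfl)) hxb
  have hleft : (disp chi tau lam 0 ((x₀ - r : ℝ) : ℂ)).re < 0 := by
    refine lt_of_lt_of_eq ?_ h0
    exact hmono (a := x₀ - r) (b := x₀) ⟨le_rfl, by linarith⟩ ⟨by linarith, by linarith⟩
      (by linarith)
  have hright : 0 < (disp chi tau lam 0 ((x₀ + r : ℝ) : ℂ)).re := by
    refine h0.symm.trans_lt ?_
    exact hmono (a := x₀) (b := x₀ + r) ⟨by linarith, by linarith⟩ ⟨by linarith, le_rfl⟩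
      (by linarith)
  have hl := (tendsto_disp_re chi tau lam (hI (x₀ - r) ⟨le_rfl, by linarith⟩).1).eventually_lt_const hleft
  have hr' := (tendsto_disp_re chi tau lam (hI (x₀ + r) ⟨by linarith, le_rfl⟩).1).eventually_const_lt hright
  obtain ⟨s, hs, hs'⟩ := Metric.eventually_nhds_iff.1
    (eventually_nhdsWithin_iff.1 ((ha.and hl).and hr'))
  refine ⟨s, hs, fun σ hσ hσs => ?_⟩
  obtain ⟨⟨h1, h2⟩, h3⟩ := hs' (y := σ) (by rwa [Real.dist_eq, sub_zero, abs_of_nonneg hσ]) hσ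
  -- The intermediate value theorem only kills the real part; on the real axis the imaginary part
  -- vanishes by `disp_im`.
  obtain ⟨μ, hμ, hμ0⟩ := intermediate_value_Icc (by linarith) (hcont σ hσ) ⟨h2.le, h3.le⟩
  obtain ⟨hμpos, hμb⟩ := hI μ hμ
  refine ⟨μ, hμpos, Complex.ext hμ0 (disp_im chi tau lam hσ hμpos), fun h => ?_⟩
  have := hab h1 hμb
  rw [h] at this
  exact lt_irrefl _ this

/-! ### Eigenvalues of the rank one perturbation on `ℓ²(ℤ)` -/

/-- The graph relation of the rank one perturbation `M` of `A`: `f = M v`. -/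
def ModeRel (chi tau lam σ : ℝ) (v f : Seq) : Prop :=
  ∀ n : ℤ, f n = -(σ * (n : ℂ) ^ 2) * v n + driftOp lam v n -
    (Real.pi * chi : ℝ) * v 0 * source tau n

/-- Moves the rank one term to the right-hand side: `(z - A) v = g - πχ v₀ s`, to which `R(z)` is
applied. -/
theorem modeRel_iff {chi tau lam σ : ℝ} (hσ : 0 ≤ σ) {z : ℂ} (hz : 0 < z.re) {v f g : Seq}
    (hf : f = z • v - g) : ModeRel chi tau lam σ v f ↔
      v = resOp lam σ z g - ((Real.pi * chi : ℝ) * v 0) • resOp lam σ z (source tau) := by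
  rw [← map_smul, ← map_sub, eq_resOp_iff hσ hz]
  refine forall_congr' fun n => ?_
  simp only [hf, lp.coeFn_sub, lp.coeFn_smul, Pi.sub_apply, Pi.smul_apply, smul_eq_mul]
  constructor <;> intro h <;> linear_combination h

/-- An eigenvector must be `-πχ v₀ R(z) s`; conversely, consistency of the coordinate at `0` is
precisely `D(z) = 0`. -/
theorem modeRel_smul_iff {chi tau lam σ : ℝ} (hσ : 0 ≤ σ) {z : ℂ} (hz : 0 < z.re)
    (hD : disp chi tau lam σ z = 0) {v : Seq} :
    ModeRel chi tau lam σ v (z • v) ↔ ∃ a : ℂ, v = a • resOp lam σ z (source tau) := by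
  rw [modeRel_iff hσ hz (sub_zero _).symm, map_zero, zero_sub, ← neg_smul]
  constructor
  · intro h
    exact ⟨_, h⟩
  · rintro ⟨a, rfl⟩
    congr 1
    rw [disp] at hD
    simp only [lp.coeFn_smul, Pi.smul_apply, smul_eq_mul]
    linear_combination a * hD

/-- No Jordan chain: the coordinate at `0` of the equation reads `v₀ D(z) = -a (R(z)² s)₀`. The left
side vanishes, while `(R(z)² s)₀` is a nonzero multiple of `D'(z)`. -/
theorem eq_zero_of_modeRel_add {chi tau lam σ : ℝ} (hσ : 0 ≤ σ) {z : ℂ} (hz : 0 < z.re)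
    (hD : disp chi tau lam σ z = 0) (hD' : dispDeriv chi tau lam σ z ≠ 0) {v : Seq} {a : ℂ}
    (h : ModeRel chi tau lam σ v (z • v + a • resOp lam σ z (source tau))) : a = 0 := by
  rw [modeRel_iff hσ hz (g := -(a • resOp lam σ z (source tau))) (by rw [sub_neg_eq_add])] at h
  have h0 := congrArg (fun v : Seq => v 0) h
  simp only [map_neg, map_smul, lp.coeFn_sub, lp.coeFn_neg, lp.coeFn_smul, Pi.sub_apply,
    Pi.neg_apply, Pi.smul_apply, smul_eq_mul] at h0
  rw [disp] at hD
  rw [dispDeriv] at hD'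
  refine (mul_eq_zero.1 ?_).resolve_right (neg_ne_zero.1 (right_ne_zero_of_mul hD'))
  linear_combination h0 - v 0 * hD

/-- The resolvent of the rank one perturbation. -/
noncomputable def modeRes (chi tau lam σ : ℝ) (z : ℂ) : Seq →L[ℂ] Seq :=
  resOp lam σ z - ((Real.pi * chi : ℝ) / disp chi tau lam σ z) •
    ((lp.evalCLM ℂ (fun _ : ℤ => ℂ) 2 0) ∘L resOp lam σ z).smulRight (resOp lam σ z (source tau))

theorem modeRes_apply (chi tau lam σ : ℝ) (z : ℂ) (g : Seq) :
    modeRes chi tau lam σ z g = resOp lam σ z g - ((Real.pi * chi : ℝ) / disp chi tau lam σ z) •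
      (resOp lam σ z g 0) • resOp lam σ z (source tau) := rfl

/-- Sherman–Morrison: the coordinate at `0` gives `D(z) v₀ = (R(z) g)₀`, which determines the
unknown scalar `v₀`. -/
theorem modeRel_iff_eq_modeRes {chi tau lam σ : ℝ} (hσ : 0 ≤ σ) {z : ℂ} (hz : 0 < z.re)
    (hD : disp chi tau lam σ z ≠ 0) {v g : Seq} :
    ModeRel chi tau lam σ v (z • v - g) ↔ v = modeRes chi tau lam σ z g := by
  rw [modeRel_iff hσ hz rfl, modeRes_apply, smul_smul]
  have key : disp chi tau lam σ z = 1 + (Real.pi * chi : ℝ) * resOp lam σ z (source tau) 0 := rfl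
  -- Both sides have the shape `R(z) g - b R(z) s`, so only the two values of the scalar `b` have to
  -- be compared.
  suffices H : ∀ b : ℂ, v = resOp lam σ z g - b • resOp lam σ z (source tau) →
      (b = (Real.pi * chi : ℝ) * v 0 ↔
        b = (Real.pi * chi : ℝ) / disp chi tau lam σ z * resOp lam σ z g 0) by
    constructor
    · intro h
      rwa [(H _ h).1 rfl] at h
    · intro h
      rwa [(H _ h).2 rfl] at h
  intro b hb
  have h0 := congrArg (fun v : Seq => v 0) hb
  simp only [lp.coeFn_sub, lp.coeFn_smul, Pi.sub_apply, Pi.smul_apply, smul_eq_mul] at h0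
  rw [div_mul_eq_mul_div, eq_div_iff hD, key]
  constructor
  · intro h
    linear_combination h + (Real.pi * chi : ℝ) * h0
  · intro h
    linear_combination h - (Real.pi * chi : ℝ) * h0

/-! ### Transfer to an operator with two equal modes -/

section Transfer

variable {E : Type*} [NormedAddCommGroup E] [NormedSpace ℂ E]

/-- `T` is conjugate, through `Φ`, to two copies of the rank one perturbation on `ℓ²(ℤ)`. -/
def IsDoubleMode (chi tau lam σ : ℝ) (T : E →ₗ.[ℂ] E) (Φ : E ≃L[ℂ] Seq × Seq) : Prop :=
  ∀ x y, (∃ h : x ∈ T.domain, T ⟨x, h⟩ = y) ↔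
    ModeRel chi tau lam σ (Φ x).1 (Φ y).1 ∧ ModeRel chi tau lam σ (Φ x).2 (Φ y).2

variable {chi tau lam σ : ℝ} {T : E →ₗ.[ℂ] E} {Φ : E ≃L[ℂ] Seq × Seq}

theorem IsDoubleMode.mem_resolventSet (hT : IsDoubleMode chi tau lam σ T Φ) (hσ : 0 ≤ σ) {z : ℂ}
    (hz : 0 < z.re) (hD : disp chi tau lam σ z ≠ 0) : z ∈ resolventSet T := by
  let M := modeRes chi tau lam σ z
  refine ⟨(Φ.symm : Seq × Seq →L[ℂ] E) ∘L (M.prodMap M) ∘L (Φ : E →L[ℂ] Seq × Seq),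
    fun y => ?_, fun x => ?_⟩
  · set x := ((Φ.symm : Seq × Seq →L[ℂ] E) ∘L (M.prodMap M) ∘L (Φ : E →L[ℂ] Seq × Seq)) y with hx
    have hΦ : Φ x = (M (Φ y).1, M (Φ y).2) := Φ.apply_symm_apply _
    obtain ⟨h, he⟩ := (hT x (z • x - y)).2 (by
      rw [map_sub, map_smul, Prod.fst_sub, Prod.snd_sub, Prod.smul_fst, Prod.smul_snd,
        modeRel_iff_eq_modeRes hσ hz hD, modeRel_iff_eq_modeRes hσ hz hD, hΦ]
      exact ⟨rfl, rfl⟩)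
    exact ⟨h, by rw [he, sub_sub_cancel]⟩
  · obtain ⟨h1, h2⟩ := (hT x (T x)).1 ⟨x.2, rfl⟩
    have e : Φ (T x) = z • Φ x - Φ (z • (x : E) - T x) := by
      rw [map_sub, map_smul, sub_sub_cancel]
    rw [e] at h1 h2
    have e1 := (modeRel_iff_eq_modeRes hσ hz hD).1 h1
    have e2 := (modeRel_iff_eq_modeRes hσ hz hD).1 h2
    change Φ.symm (M (Φ (z • (x : E) - T x)).1, M (Φ (z • (x : E) - T x)).2) = x
    rw [ContinuousLinearEquiv.symm_apply_eq]
    exact Prod.ext e1.symm e2.symm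

/-- A nonzero derivative keeps `D` away from `0` on a punctured neighbourhood, where the resolvent
therefore exists. -/
theorem IsDoubleMode.isIsolated (hT : IsDoubleMode chi tau lam σ T Φ) (hσ : 0 ≤ σ) {z : ℂ}
    (hz : 0 < z.re) (hD' : dispDeriv chi tau lam σ z ≠ 0) : IsIsolated T z := by
  filter_upwards [(hasDerivAt_disp chi tau lam hσ hz).eventually_ne (c := 0) hD',
    nhdsWithin_le_nhds (eventually_re_pos hz)] with w h1 h2
  exact hT.mem_resolventSet hσ h2 h1

theorem IsDoubleMode.mem_eigenspace_iff (hT : IsDoubleMode chi tau lam σ T Φ) (hσ : 0 ≤ σ) {z : ℂ}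
    (hz : 0 < z.re) (hD : disp chi tau lam σ z = 0) (x : E) :
    x ∈ eigenspace T z ↔ ∃ a b : ℂ,
      Φ x = (a • resOp lam σ z (source tau), b • resOp lam σ z (source tau)) := by
  rw [mem_eigenspace, hT, map_smul, Prod.smul_fst, Prod.smul_snd, modeRel_smul_iff hσ hz hD,
    modeRel_smul_iff hσ hz hD]
  simp only [Prod.ext_iff, exists_and_left, exists_and_right]

theorem IsDoubleMode.finrank_eigenspace (hT : IsDoubleMode chi tau lam σ T Φ) (hσ : 0 ≤ σ) {z : ℂ}
    (hz : 0 < z.re) (hD : disp chi tau lam σ z = 0) : Module.finrank ℂ (eigenspace T z) = 2 := by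
  set ψ := resOp lam σ z (source tau) with hψ
  have hψ0 : ψ ≠ 0 := by
    intro h
    rw [disp, ← hψ, h] at hD
    simp at hD
  let F : ℂ × ℂ →ₗ[ℂ] E := Φ.symm.toLinearEquiv.toLinearMap ∘ₗ
    ((LinearMap.toSpanSingleton ℂ Seq ψ).prodMap (LinearMap.toSpanSingleton ℂ Seq ψ))
  have hF : ∀ p, Φ (F p) = (p.1 • ψ, p.2 • ψ) := fun p => Φ.apply_symm_apply _
  have hinj : Function.Injective F := by
    intro p p' h
    have h' := congrArg Φ h
    rw [hF, hF, Prod.mk.injEq] at h'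
    exact Prod.ext (smul_left_injective ℂ hψ0 h'.1) (smul_left_injective ℂ hψ0 h'.2)
  have hr : eigenspace T z = LinearMap.range F := by
    ext x
    rw [hT.mem_eigenspace_iff hσ hz hD, LinearMap.mem_range]
    constructor
    · rintro ⟨a, b, h⟩
      exact ⟨(a, b), Φ.injective (by rw [hF, h])⟩
    · rintro ⟨p, rfl⟩
      exact ⟨p.1, p.2, hF p⟩
  rw [hr, LinearMap.finrank_range_of_inj hinj, Module.finrank_prod, Module.finrank_self]

/-- Inductively `(T - z) x` is an eigenvector; the absence of Jordan chains in each copy forces it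
to vanish. -/
theorem IsDoubleMode.kerPow_le_eigenspace (hT : IsDoubleMode chi tau lam σ T Φ) (hσ : 0 ≤ σ) {z : ℂ}
    (hz : 0 < z.re) (hD : disp chi tau lam σ z = 0) (hD' : dispDeriv chi tau lam σ z ≠ 0) (n : ℕ) :
    kerPow T z n ≤ eigenspace T z := by
  induction n with
  | zero => exact bot_le
  | succ n ih =>
    intro x hx
    obtain ⟨hxd, h⟩ := (mem_shiftPreimage T z _ x).1 hx
    obtain ⟨a, b, hab⟩ := (hT.mem_eigenspace_iff hσ hz hD _).1 (ih h)
    obtain ⟨h1, h2⟩ := (hT x (T ⟨x, hxd⟩)).1 ⟨hxd, rfl⟩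
    have e : Φ (T ⟨x, hxd⟩) = z • Φ x +
        (a • resOp lam σ z (source tau), b • resOp lam σ z (source tau)) := by
      rw [← hab, map_sub, map_smul, add_sub_cancel]
    rw [e] at h1 h2
    have ha := eq_zero_of_modeRel_add hσ hz hD hD' h1
    have hb := eq_zero_of_modeRel_add hσ hz hD hD' h2
    rw [mem_eigenspace]
    refine ⟨hxd, Φ.injective ?_⟩
    rw [e, ha, hb, map_smul, zero_smul, Prod.mk_zero_zero, add_zero]

theorem IsDoubleMode.genEigenspace_eq (hT : IsDoubleMode chi tau lam σ T Φ) (hσ : 0 ≤ σ) {z : ℂ}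
    (hz : 0 < z.re) (hD : disp chi tau lam σ z = 0) (hD' : dispDeriv chi tau lam σ z ≠ 0) :
    genEigenspace T z = eigenspace T z :=
  le_antisymm (iSup_le fun n => hT.kerPow_le_eigenspace hσ hz hD hD' n)
    (le_iSup (fun n => kerPow T z n) 1)

end Transfer

/-! ### Fourier coefficients on `L²` of the torus -/

/-- The exponential `θ ↦ exp (i n θ)` as an element of `L²`. -/
noncomputable def expL2 (n : ℤ) : L2 :=
  ContinuousMap.toLp (E := ℂ) 2 (volume : Measure Circ) ℂ (fourier n)

theorem coeFn_expL2 (n : ℤ) : (expL2 n : Circ → ℂ) =ᵐ[volume] fourier n :=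
  ContinuousMap.coeFn_toLp (E := ℂ) (p := 2) (𝕜 := ℂ) (volume : Measure Circ) (fourier n)

theorem two_pi_mul_fourierCoeff (u : Circ → ℂ) (n : ℤ) :
    (2 * Real.pi : ℝ) * fourierCoeff u n = ∫ t : Circ, fourier (-n) t * u t := by
  rw [fourierCoeff, AddCircle.integral_haarAddCircle, Complex.real_smul, ← mul_assoc,
    ← Complex.ofReal_mul, mul_inv_cancel₀ Real.two_pi_pos.ne', Complex.ofReal_one, one_mul]
  rfl

theorem inner_expL2 (n : ℤ) (u : L2) :
    ⟪expL2 n, u⟫_ℂ = (2 * Real.pi : ℝ) * fourierCoeff (u : Circ → ℂ) n := by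
  rw [two_pi_mul_fourierCoeff, L2.inner_def]
  refine integral_congr_ae ?_
  filter_upwards [coeFn_expL2 n] with t ht
  rw [ht, fourier_neg, RCLike.inner_apply, mul_comm]

theorem fourierCoeff_expL2 (m n : ℤ) :
    fourierCoeff (expL2 m : Circ → ℂ) n = if n = m then 1 else 0 := by
  have h : fourierCoeff (expL2 m : Circ → ℂ) n =
      ⟪(fourierLp 2 n : Lp ℂ 2 (AddCircle.haarAddCircle (T := 2 * Real.pi))), fourierLp 2 m⟫_ℂ := by
    rw [L2.inner_def, fourierCoeff]
    have h1 : (expL2 m : Circ → ℂ) =ᵐ[AddCircle.haarAddCircle] fourier m := by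
      have := coeFn_expL2 m
      exact (Measure.ae_ennreal_smul_measure_iff (μ := AddCircle.haarAddCircle)
        (c := ENNReal.ofReal (2 * Real.pi)) (by simp [Real.pi_pos])).1 this
    refine integral_congr_ae ?_
    filter_upwards [h1, coeFn_fourierLp 2 n, coeFn_fourierLp 2 m] with t e1 e2 e3
    rw [e1, e2, e3, fourier_neg, RCLike.inner_apply]
    exact mul_comm _ _
  rw [h, orthonormal_iff_ite.1 orthonormal_fourier]

theorem eq_zero_of_fourierCoeff {v : L2} (hc : ∀ n : ℤ, fourierCoeff (v : Circ → ℂ) n = 0) :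
    v = 0 := by
  have hv : MemLp (v : Circ → ℂ) 2 AddCircle.haarAddCircle := (Lp.memLp v).haarAddCircle
  have hz : hv.toLp = 0 := by
    apply fourierBasis.repr.injective
    ext n
    rw [fourierBasis_repr, fourierCoeff_congr_ae hv.coeFn_toLp, hc n, map_zero]
    rfl
  have hae : (v : Circ → ℂ) =ᵐ[AddCircle.haarAddCircle] 0 := by
    refine hv.coeFn_toLp.symm.trans ?_
    rw [hz]
    exact Lp.coeFn_zero _ _ _
  rw [Lp.eq_zero_iff_ae_eq_zero]
  exact Measure.ae_smul_measure hae (ENNReal.ofReal (2 * Real.pi))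

/-- The normalisation factor of the exponentials. -/
noncomputable def expNorm : ℝ := √(2 * Real.pi)

theorem expNorm_pos : 0 < expNorm := Real.sqrt_pos.2 Real.two_pi_pos

theorem expNorm_mul_self : (expNorm : ℂ) * expNorm = (2 * Real.pi : ℝ) := by
  rw [← Complex.ofReal_mul, expNorm, Real.mul_self_sqrt Real.two_pi_pos.le]

theorem expNorm_ne_zero : (expNorm : ℂ) ≠ 0 := Complex.ofReal_ne_zero.2 expNorm_pos.ne'

theorem orthonormal_expL2 : Orthonormal ℂ fun n : ℤ => ((expNorm : ℂ)⁻¹ • expL2 n : L2) := by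
  rw [orthonormal_iff_ite]
  intro m n
  rw [inner_smul_left, inner_smul_right, inner_expL2, fourierCoeff_expL2, ← Complex.ofReal_inv,
    Complex.conj_ofReal, Complex.ofReal_inv, ← expNorm_mul_self]
  have := expNorm_ne_zero
  split_ifs <;> field_simp

/-- The Hilbert basis of normalised exponentials. -/
noncomputable def expBasis : HilbertBasis ℤ ℂ L2 :=
  HilbertBasis.mkOfOrthogonalEqBot orthonormal_expL2 (by
    rw [Submodule.eq_bot_iff]
    intro u hu
    refine eq_zero_of_fourierCoeff fun n => ?_
    have h := (Submodule.mem_orthogonal _ u).1 hu _ (Submodule.subset_span ⟨n, rfl⟩)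
    rw [inner_smul_left, inner_expL2] at h
    have h1 : conj (expNorm : ℂ)⁻¹ ≠ 0 := by simp [expNorm_pos.ne']
    have h2 : ((2 * Real.pi : ℝ) : ℂ) ≠ 0 := Complex.ofReal_ne_zero.2 Real.two_pi_pos.ne'
    exact ((mul_eq_zero.1 ((mul_eq_zero.1 h).resolve_left h1)).resolve_left h2))

theorem expBasis_apply (n : ℤ) : expBasis n = (expNorm : ℂ)⁻¹ • expL2 n := by
  rw [expBasis, HilbertBasis.coe_mkOfOrthogonalEqBot]

theorem expBasis_repr (u : L2) (n : ℤ) :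
    expBasis.repr u n = expNorm * fourierCoeff (u : Circ → ℂ) n := by
  rw [HilbertBasis.repr_apply_apply, expBasis_apply, inner_smul_left, inner_expL2,
    ← Complex.ofReal_inv, Complex.conj_ofReal, Complex.ofReal_inv, ← expNorm_mul_self]
  have := expNorm_ne_zero
  field_simp

/-- The Fourier coefficients as an equivalence of `L²` and `ℓ²(ℤ)`. -/
noncomputable def coeffEquiv : L2 ≃L[ℂ] Seq :=
  expBasis.repr.toContinuousLinearEquiv.trans
    -- The coordinates in the orthonormal basis are `√(2π)` times the Fourier coefficients; this
    -- factor is undone here, so the equivalence is not isometric.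
    (ContinuousLinearEquiv.smulLeft (Units.mk0 (expNorm : ℂ)⁻¹ (inv_ne_zero expNorm_ne_zero)))

theorem coeffEquiv_apply (u : L2) (n : ℤ) :
    coeffEquiv u n = fourierCoeff (u : Circ → ℂ) n := by
  change (expNorm : ℂ)⁻¹ * expBasis.repr u n = _
  rw [expBasis_repr, ← mul_assoc, inv_mul_cancel₀ expNorm_ne_zero, one_mul]

theorem two_pi_mul_coeffEquiv (u : L2) (n : ℤ) :
    (2 * Real.pi : ℝ) * coeffEquiv u n = ∫ t : Circ, fourier (-n) t * u t := by
  rw [coeffEquiv_apply, two_pi_mul_fourierCoeff]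

theorem coeffEquiv_expL2 (m n : ℤ) : coeffEquiv (expL2 m) n = if n = m then 1 else 0 := by
  rw [coeffEquiv_apply, fourierCoeff_expL2]

theorem hasSum_coeffEquiv (u : L2) : HasSum (fun n => coeffEquiv u n • expL2 n) u := by
  have e : (fun n => coeffEquiv u n • expL2 n) = fun n => expBasis.repr u n • expBasis n := by
    ext1 n
    rw [coeffEquiv_apply, expBasis_repr, expBasis_apply, smul_smul, mul_right_comm,
      mul_inv_cancel₀ expNorm_ne_zero, one_mul]
  rw [e]
  exact expBasis.hasSum_repr u

/-! ### Multiplication by cosines and integration, in Fourier coefficients -/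

theorem circCos_eq (m : ℕ) (t : Circ) :
    circCos m t = (fourier (m : ℤ) t + fourier (-(m : ℤ)) t) / 2 := by
  induction t using QuotientAddGroup.induction_on with
  | H x =>
    rw [circCos_coe, fourier_coe_apply, fourier_coe_apply, Complex.ofReal_cos, Complex.cos]
    have hπ : (Real.pi : ℂ) ≠ 0 := Complex.ofReal_ne_zero.2 Real.pi_ne_zero
    congr 3
    · push_cast
      field_simp
    · push_cast
      field_simp

theorem bar_eq (u : L2) : bar u = (2 * Real.pi : ℝ) * coeffEquiv u 0 := by
  rw [two_pi_mul_coeffEquiv]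
  simp [bar]

theorem cosL2_eq (m : ℕ) : cosL2 m = (1 / 2 : ℂ) • (expL2 m + expL2 (-m)) := by
  rw [cosL2, expL2, expL2, ← map_add, ← map_smul]
  congr 1
  ext t
  rw [circCos_eq]
  simp
  ring

theorem coeffEquiv_cosL2 (m : ℕ) (n : ℤ) : coeffEquiv (cosL2 m) n =
    ((if n = m then 1 else 0) + (if n = -m then 1 else 0)) / 2 := by
  rw [cosL2_eq, map_smul, map_add, lp.coeFn_smul, Pi.smul_apply, lp.coeFn_add, Pi.add_apply,
    coeffEquiv_expL2, coeffEquiv_expL2, smul_eq_mul]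
  ring

theorem integrable_fourier_mul (u : L2) (n : ℤ) :
    Integrable (fun t : Circ => fourier n t * u t) volume := by
  have h0 : Integrable (u : Circ → ℂ) volume := (Lp.memLp u).integrable (by norm_num)
  exact h0.bdd_mul (c := 1) (fourier n).continuous.aestronglyMeasurable
    (Eventually.of_forall fun t => by
      rw [fourier_apply]
      exact (Circle.norm_coe _).le)

theorem coeffEquiv_mulOp_cos (u : L2) (n : ℤ) :
    coeffEquiv (mulOp (circCos 1) u) n = (coeffEquiv u (n - 1) + coeffEquiv u (n + 1)) / 2 := by
  have h2 : ((2 * Real.pi : ℝ) : ℂ) ≠ 0 := Complex.ofReal_ne_zero.2 Real.two_pi_pos.ne'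
  refine mul_left_cancel₀ h2 ?_
  rw [mul_div_assoc', mul_add, two_pi_mul_coeffEquiv, two_pi_mul_coeffEquiv, two_pi_mul_coeffEquiv,
    ← integral_add (integrable_fourier_mul u _) (integrable_fourier_mul u _), ← integral_div]
  refine integral_congr_ae ?_
  filter_upwards [coeFn_mulOp (circCos 1) u] with t ht
  rw [ht, circCos_eq, show -(n - 1) = -n + 1 by ring, show -(n + 1) = -n + -1 by ring, fourier_add,
    fourier_add]
  push_cast
  ring

/-! ### Weak derivatives in Fourier coefficients -/

theorem hasDerivAt_fourier_two_pi (n : ℤ) (x : ℝ) :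
    HasDerivAt (fun y : ℝ => (fourier n (y : Circ) : ℂ))
      (Complex.I * n * fourier n (x : Circ)) x := by
  refine (hasDerivAt_fourier (2 * Real.pi) n x).congr_deriv ?_
  have hπ : (Real.pi : ℂ) ≠ 0 := Complex.ofReal_ne_zero.2 Real.pi_ne_zero
  push_cast
  field_simp

theorem contDiff_fourier (n : ℤ) : ContDiff ℝ ∞ fun x : ℝ => (fourier n (x : Circ) : ℂ) := by
  simp only [fourier_coe_apply]
  refine ContDiff.cexp (ContDiff.div_const (contDiff_const.mul ?_) _)
  exact Complex.ofRealCLM.contDiff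

theorem periodic_fourier (n : ℤ) :
    Function.Periodic (fun x : ℝ => (fourier n (x : Circ) : ℂ)) (2 * Real.pi) := fun x => by
  simp only [AddCircle.coe_add_period]

theorem two_pi_mul_coeffEquiv_eq_interval (u : L2) (n : ℤ) :
    (2 * Real.pi : ℝ) * coeffEquiv u n =
      ∫ x in (0)..(2 * Real.pi), u (x : Circ) * fourier (-n) (x : Circ) := by
  have h := AddCircle.intervalIntegral_preimage (2 * Real.pi) 0
    (fun t : Circ => u t * fourier (-n) t)
  rw [zero_add] at h
  rw [h, two_pi_mul_coeffEquiv]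
  simp only [mul_comm]

theorem IsWeakDeriv.coeffEquiv_eq {u v : L2} (h : IsWeakDeriv u v) (n : ℤ) :
    coeffEquiv v n = Complex.I * n * coeffEquiv u n := by
  have h2 : ((2 * Real.pi : ℝ) : ℂ) ≠ 0 := Complex.ofReal_ne_zero.2 Real.two_pi_pos.ne'
  refine mul_left_cancel₀ h2 ?_
  have h1 := h _ (contDiff_fourier (-n)) (periodic_fourier (-n))
  rw [← two_pi_mul_coeffEquiv_eq_interval v n] at h1
  rw [mul_left_comm, two_pi_mul_coeffEquiv_eq_interval u n, ← neg_eq_iff_eq_neg.2 h1,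
    ← intervalIntegral.integral_neg, ← intervalIntegral.integral_const_mul]
  refine intervalIntegral.integral_congr fun x _ => ?_
  simp only [(hasDerivAt_fourier_two_pi (-n) x).deriv]
  push_cast
  ring

/-- The continuous functional `u ↦ ∫ u g`. -/
noncomputable def pairing (g : C(Circ, ℂ)) : L2 →L[ℂ] ℂ :=
  ((2 * Real.pi : ℝ) : ℂ) • (lp.evalCLM ℂ (fun _ : ℤ => ℂ) 2 0 ∘L (coeffEquiv : L2 →L[ℂ] Seq) ∘L
    (ContinuousLinearMap.mul ℂ ℂ).holderL volume ∞ 2 2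
      (ContinuousMap.toLp (E := ℂ) ∞ (volume : Measure Circ) ℂ g))

theorem pairing_apply (g : C(Circ, ℂ)) (u : L2) :
    pairing g u = ∫ x in (0)..(2 * Real.pi), u (x : Circ) * g (x : Circ) := by
  have h := AddCircle.intervalIntegral_preimage (2 * Real.pi) 0 (fun t : Circ => u t * g t)
  rw [zero_add] at h
  rw [h]
  change ((2 * Real.pi : ℝ) : ℂ) * coeffEquiv (mulOp g u) 0 = _
  rw [← bar_eq]
  refine integral_congr_ae ?_
  filter_upwards [coeFn_mulOp g u] with t ht
  rw [ht, mul_comm]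

theorem exists_continuousMap_of_periodic {φ : ℝ → ℂ} (hφ : Continuous φ)
    (hp : Function.Periodic φ (2 * Real.pi)) : ∃ g : C(Circ, ℂ), ∀ x : ℝ, g (x : Circ) = φ x :=
  ⟨⟨hp.lift, continuous_coinduced_dom.mpr hφ⟩, fun x => hp.lift_coe x⟩

theorem isWeakDeriv_expL2 (n : ℤ) : IsWeakDeriv (expL2 n) ((Complex.I * n) • expL2 n) := by
  intro φ hφ hp
  rw [integral_smul_L2, integral_congr_L2 (coeFn_expL2 n), integral_congr_L2 (coeFn_expL2 n)]
  have hd : ∀ x, HasDerivAt φ (deriv φ x) x := fun x =>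
    (hφ.differentiable (by simp) x).hasDerivAt
  rw [intervalIntegral.integral_mul_deriv_eq_deriv_mul
    (u := fun x : ℝ => (fourier n (x : Circ) : ℂ))
    (u' := fun x : ℝ => Complex.I * n * fourier n (x : Circ))
    (fun x _ => hasDerivAt_fourier_two_pi n x) (fun x _ => hd x)
    (Continuous.intervalIntegrable (continuous_const.mul (contDiff_fourier n).continuous) _ _)
    ((hφ.continuous_deriv (by simp)).intervalIntegrable _ _)]
  have h1 : (fourier n ((2 * Real.pi : ℝ) : Circ) : ℂ) = fourier n ((0 : ℝ) : Circ) := by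
    simpa only [zero_add] using periodic_fourier n 0
  have h2 : φ (2 * Real.pi) = φ 0 := by simpa only [zero_add] using hp 0
  rw [h1, h2, sub_self, zero_sub, ← intervalIntegral.integral_const_mul]
  simp only [mul_assoc]

/-- For the converse, both sides of the defining identity are continuous functionals on `L²`, so it
can be checked termwise on the Fourier series, where it is integration by parts for exponentials. -/
theorem isWeakDeriv_iff {u v : L2} :
    IsWeakDeriv u v ↔ ∀ n : ℤ, coeffEquiv v n = Complex.I * n * coeffEquiv u n := by
  refine ⟨fun h n => h.coeffEquiv_eq n, fun h φ hφ hp => ?_⟩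
  have hp' : Function.Periodic (deriv φ) (2 * Real.pi) := fun x => by
    rw [← deriv_comp_add_const, show (fun x => φ (x + 2 * Real.pi)) = φ from funext hp]
  obtain ⟨g, hg⟩ := exists_continuousMap_of_periodic hφ.continuous hp
  obtain ⟨g', hg'⟩ := exists_continuousMap_of_periodic (hφ.continuous_deriv (by simp)) hp'
  have key : ∀ w w' : L2, (∫ x in (0)..(2 * Real.pi), w (x : Circ) * deriv φ x =
      -∫ x in (0)..(2 * Real.pi), w' (x : Circ) * φ x) ↔ pairing g' w = -pairing g w' := by
    intro w w'
    simp only [pairing_apply, hg, hg']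
  rw [key]
  have hs := (hasSum_coeffEquiv u).mapL (pairing g')
  have hs' := ((hasSum_coeffEquiv v).mapL (pairing g)).neg
  suffices e : (fun n => pairing g' (coeffEquiv u n • expL2 n)) =
      fun n => -pairing g (coeffEquiv v n • expL2 n) by
    rw [e] at hs
    exact hs.unique hs'
  ext1 n
  have hn := (key _ _).1 (isWeakDeriv_expL2 n φ hφ hp)
  rw [map_smul, map_smul, hn, h n, map_smul, smul_eq_mul, smul_eq_mul, smul_eq_mul]
  ring

theorem mem_secondDerivGraph_iff {u w : L2} :
    (u, w) ∈ secondDerivGraph ↔ ∀ n : ℤ, coeffEquiv w n = -(n : ℂ) ^ 2 * coeffEquiv u n := by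
  constructor
  · rintro ⟨v, h1, h2⟩ n
    rw [isWeakDeriv_iff.1 h2 n, isWeakDeriv_iff.1 h1 n]
    linear_combination (n : ℂ) ^ 2 * coeffEquiv u n * Complex.I_mul_I
  · intro h
    have hmem : Memℓp (fun n : ℤ => Complex.I * n * coeffEquiv u n) 2 := by
      refine Memℓp.mono (((lp.memℓp (coeffEquiv u)).norm).add ((lp.memℓp (coeffEquiv w)).norm))
        fun n => ?_
      -- With `wₙ = -n² uₙ` this gives `|n uₙ| ≤ |uₙ| + |wₙ|`: the intermediate derivative is
      -- automatically in `L²`.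
      have h1 : |(n : ℝ)| ≤ 1 + (n : ℝ) ^ 2 := by
        rw [← sq_abs]
        nlinarith [sq_nonneg (|(n : ℝ)| - 1), abs_nonneg (n : ℝ)]
      simp only [Pi.add_apply]
      rw [h n, norm_mul, norm_mul, norm_mul, Complex.norm_I, one_mul, norm_neg, norm_pow,
        Complex.norm_intCast, sq_abs]
      nlinarith [norm_nonneg (coeffEquiv u n)]
    have hv : ∀ n, coeffEquiv (coeffEquiv.symm ⟨_, hmem⟩) n = Complex.I * n * coeffEquiv u n := by
      intro n
      rw [ContinuousLinearEquiv.apply_symm_apply]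
    refine ⟨coeffEquiv.symm ⟨_, hmem⟩, isWeakDeriv_iff.2 hv, isWeakDeriv_iff.2 fun n => ?_⟩
    rw [hv n, h n]
    linear_combination -(n : ℂ) ^ 2 * coeffEquiv u n * Complex.I_mul_I

theorem mem_secondDeriv_iff {u w : L2} :
    (∃ h : u ∈ secondDeriv.domain, secondDeriv ⟨u, h⟩ = w) ↔
      ∀ n : ℤ, coeffEquiv w n = -(n : ℂ) ^ 2 * coeffEquiv u n := by
  rw [← mem_secondDerivGraph_iff, ← secondDeriv_graph, LinearPMap.mem_graph_iff]
  constructor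
  · rintro ⟨h, he⟩
    exact ⟨⟨u, h⟩, rfl, he⟩
  · rintro ⟨⟨u', h⟩, rfl, he⟩
    exact ⟨h, he⟩

/-! ### The conjugation with two copies of the mode operator -/

theorem norm_zpow_le_one (s : ℂ) (hs : ‖s‖ = 1) (n : ℤ) : ‖s ^ n‖ ≤ 1 := by
  rw [norm_zpow, hs, one_zpow]

/-- The diagonal operator with entries `s ^ n`, for `s` of modulus one. -/
noncomputable def twistOp (s : ℂ) (hs : ‖s‖ = 1) : Seq →L[ℂ] Seq :=
  diagOp (fun n => s ^ n) 1 (norm_zpow_le_one s hs)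

theorem norm_neg_I : ‖-Complex.I‖ = 1 := by simp

theorem zpow_I_mul_zpow_neg_I (n : ℤ) : Complex.I ^ n * (-Complex.I) ^ n = 1 := by
  rw [← mul_zpow, mul_neg, Complex.I_mul_I, neg_neg, one_zpow]

theorem twistOp_I_neg_I (v : Seq) :
    twistOp Complex.I Complex.norm_I (twistOp (-Complex.I) norm_neg_I v) = v := by
  ext n
  simp only [twistOp, diagOp_apply]
  rw [← mul_assoc, zpow_I_mul_zpow_neg_I, one_mul]

theorem twistOp_neg_I_I (v : Seq) :
    twistOp (-Complex.I) norm_neg_I (twistOp Complex.I Complex.norm_I v) = v := by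
  ext n
  simp only [twistOp, diagOp_apply]
  rw [← mul_assoc, mul_comm ((-Complex.I) ^ n), zpow_I_mul_zpow_neg_I, one_mul]

/-- The equivalence `(a, b) ↦ ((-i)ⁿ (a n + i b n), iⁿ (a n - i b n))`. -/
noncomputable def modeEquiv : (Seq × Seq) ≃L[ℂ] Seq × Seq :=
  ContinuousLinearEquiv.equivOfInverse
    (((twistOp (-Complex.I) norm_neg_I) ∘L
        (ContinuousLinearMap.fst ℂ Seq Seq + Complex.I • ContinuousLinearMap.snd ℂ Seq Seq)).prod
      ((twistOp Complex.I Complex.norm_I) ∘L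
        (ContinuousLinearMap.fst ℂ Seq Seq - Complex.I • ContinuousLinearMap.snd ℂ Seq Seq)))
    (((1 / 2 : ℂ) • ((twistOp Complex.I Complex.norm_I) ∘L ContinuousLinearMap.fst ℂ Seq Seq +
        (twistOp (-Complex.I) norm_neg_I) ∘L ContinuousLinearMap.snd ℂ Seq Seq)).prod
      ((-Complex.I / 2) • ((twistOp Complex.I Complex.norm_I) ∘L ContinuousLinearMap.fst ℂ Seq Seq -
        (twistOp (-Complex.I) norm_neg_I) ∘L ContinuousLinearMap.snd ℂ Seq Seq)))
    (by
      rintro ⟨a, b⟩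
      simp only [ContinuousLinearMap.prod_apply, ContinuousLinearMap.comp_apply, add_apply,
        sub_apply, smul_apply, ContinuousLinearMap.coe_fst', ContinuousLinearMap.coe_snd',
        twistOp_I_neg_I, twistOp_neg_I_I]
      refine Prod.ext ?_ ?_
      · module
      · simp only [add_sub_sub_cancel, smul_add, smul_smul]
        have h : -Complex.I / 2 * Complex.I = 1 / 2 := by
          linear_combination (-1 / 2 : ℂ) * Complex.I_mul_I
        rw [h]
        module)
    (by
      rintro ⟨v, w⟩
      simp only [ContinuousLinearMap.prod_apply, ContinuousLinearMap.comp_apply, add_apply,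
        sub_apply, smul_apply, ContinuousLinearMap.coe_fst', ContinuousLinearMap.coe_snd']
      have h : Complex.I * (-Complex.I / 2) = 1 / 2 := by
        linear_combination (-1 / 2 : ℂ) * Complex.I_mul_I
      have h1 : ∀ p q : Seq, (1 / 2 : ℂ) • (p + q) + Complex.I • (-Complex.I / 2) • (p - q) = p := by
        intro p q
        rw [smul_smul, h]
        module
      have h2 : ∀ p q : Seq, (1 / 2 : ℂ) • (p + q) - Complex.I • (-Complex.I / 2) • (p - q) = q := by
        intro p q
        rw [smul_smul, h]
        module
      rw [h1, h2, twistOp_I_neg_I, twistOp_neg_I_I])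

/-- The Fourier coefficients of the two decoupled combinations of the components. -/
noncomputable def vecModeEquiv : L2Vec ≃L[ℂ] Seq × Seq :=
  ((WithLp.prodContinuousLinearEquiv 2 ℂ L2 L2).trans (coeffEquiv.prodCongr coeffEquiv)).trans
    modeEquiv

theorem vecModeEquiv_fst (x : L2Vec) (n : ℤ) : (vecModeEquiv x).1 n =
    (-Complex.I) ^ n * (coeffEquiv (fstL x) n + Complex.I * coeffEquiv (sndL x) n) := rfl

theorem vecModeEquiv_snd (x : L2Vec) (n : ℤ) : (vecModeEquiv x).2 n =
    Complex.I ^ n * (coeffEquiv (fstL x) n - Complex.I * coeffEquiv (sndL x) n) := rfl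

/-! ### The graph of the operator in Fourier coefficients -/

theorem L2Vec_ext {x y : L2Vec} (h1 : fstL x = fstL y) (h2 : sndL x = sndL y) : x = y :=
  (WithLp.linearEquiv 2 ℂ (L2 × L2)).injective (Prod.ext h1 h2)

theorem coeffEquiv_ext_iff {u v : L2} : u = v ↔ ∀ n, coeffEquiv u n = coeffEquiv v n := by
  rw [← coeffEquiv.injective.eq_iff, lp.ext_iff, funext_iff]

theorem secondDerivVec_iff {x w : L2Vec} :
    (∃ h : x ∈ secondDerivVec.domain, secondDerivVec ⟨x, h⟩ = w) ↔
      (∀ n : ℤ, coeffEquiv (fstL w) n = -(n : ℂ) ^ 2 * coeffEquiv (fstL x) n) ∧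
      ∀ n : ℤ, coeffEquiv (sndL w) n = -(n : ℂ) ^ 2 * coeffEquiv (sndL x) n := by
  rw [← mem_secondDeriv_iff, ← mem_secondDeriv_iff]
  constructor
  · rintro ⟨h, rfl⟩
    exact ⟨⟨h.1, rfl⟩, ⟨h.2, rfl⟩⟩
  · rintro ⟨⟨h1, e1⟩, ⟨h2, e2⟩⟩
    exact ⟨⟨h1, h2⟩, L2Vec_ext e1 e2⟩

/-- The bounded part of the operator. -/
noncomputable def opBdd (chi tau lam : ℝ) : L2Vec →ₗ[ℂ] L2Vec :=
  opV lam + (chi : ℂ) • opBbar tau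

/-- One coefficientwise description of the graph, domain condition included, for both cases of the
definition: for `σ = 0` the condition is vacuous, for `σ > 0` it encodes `H²`. -/
theorem opL_iff {chi tau lam σ : ℝ} {x y : L2Vec} :
    (∃ h : x ∈ (opL chi tau lam σ).domain, opL chi tau lam σ ⟨x, h⟩ = y) ↔
      (∀ n : ℤ, coeffEquiv (fstL y) n = -(σ * (n : ℂ) ^ 2) * coeffEquiv (fstL x) n +
        coeffEquiv (fstL (opBdd chi tau lam x)) n) ∧
      ∀ n : ℤ, coeffEquiv (sndL y) n = -(σ * (n : ℂ) ^ 2) * coeffEquiv (sndL x) n +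
        coeffEquiv (sndL (opBdd chi tau lam x)) n := by
  rcases eq_or_ne σ 0 with rfl | hσ
  · have e : opL chi tau lam 0 = opBdd chi tau lam +ᵥ (0 : L2Vec →ₗ.[ℂ] L2Vec) := by
      rw [opL, diffusion, if_pos rfl, opBdd]
    rw [e]
    simp only [Complex.ofReal_zero, zero_mul, neg_zero, zero_add, ← coeffEquiv_ext_iff]
    constructor
    · rintro ⟨h, rfl⟩
      rw [LinearPMap.vadd_apply, LinearPMap.zero_apply, add_zero]
      exact ⟨rfl, rfl⟩
    · rintro ⟨h1, h2⟩
      refine ⟨Submodule.mem_top, ?_⟩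
      rw [LinearPMap.vadd_apply, LinearPMap.zero_apply, add_zero]
      exact (L2Vec_ext h1 h2).symm
  · have e : opL chi tau lam σ = opBdd chi tau lam +ᵥ (σ : ℂ) • secondDerivVec := by
      rw [opL, diffusion, if_neg hσ, opBdd]
    have hσ' : (σ : ℂ) ≠ 0 := Complex.ofReal_ne_zero.2 hσ
    have e2 : (∃ h : x ∈ (opL chi tau lam σ).domain, opL chi tau lam σ ⟨x, h⟩ = y) ↔
        ∃ h : x ∈ secondDerivVec.domain,
          secondDerivVec ⟨x, h⟩ = (σ : ℂ)⁻¹ • (y - opBdd chi tau lam x) := by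
      rw [e]
      refine exists_congr fun h => ?_
      rw [eq_inv_smul_iff₀ hσ', eq_sub_iff_add_eq, add_comm]
      rfl
    rw [e2, secondDerivVec_iff]
    have key : ∀ p q r s : ℂ, (σ : ℂ)⁻¹ * (p - q) = -r * s ↔ p = -(σ * r) * s + q := by
      intro p q r s
      rw [inv_mul_eq_iff_eq_mul₀ hσ', sub_eq_iff_eq_add]
      constructor <;> intro h <;> rw [h] <;> ring
    simp only [map_smul, map_sub, lp.coeFn_smul, lp.coeFn_sub, Pi.smul_apply, Pi.sub_apply,
      smul_eq_mul, key]

/-! ### Matching the operator with the mode operator -/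

theorem coeffEquiv_fstL_opBdd (chi tau lam : ℝ) (x : L2Vec) (n : ℤ) :
    coeffEquiv (fstL (opBdd chi tau lam x)) n =
      -lam * ((coeffEquiv (sndL x) (n - 1) + coeffEquiv (sndL x) (n + 1)) / 2) +
      Real.pi * chi * (-tau * coeffEquiv (fstL x) 0 *
          ((if n = 2 then 1 else 0) + (if n = -2 then 1 else 0)) +
        coeffEquiv (sndL x) 0 * ((if n = 1 then 1 else 0) + (if n = -1 then 1 else 0))) := by
  have e : fstL (opBdd chi tau lam x) = (lam : ℂ) • -(mulOp (circCos 1) (sndL x)) +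
      (chi : ℂ) • (bar (fstL x) • (-(tau : ℂ) • cosL2 2) + bar (sndL x) • cosL2 1) := rfl
  rw [e]
  simp only [map_add, map_smul, map_neg, lp.coeFn_add, lp.coeFn_smul, lp.coeFn_neg, Pi.add_apply,
    Pi.smul_apply, Pi.neg_apply, smul_eq_mul, coeffEquiv_mulOp_cos, coeffEquiv_cosL2, bar_eq]
  push_cast
  ring

theorem coeffEquiv_sndL_opBdd (chi tau lam : ℝ) (x : L2Vec) (n : ℤ) :
    coeffEquiv (sndL (opBdd chi tau lam x)) n =
      lam * ((coeffEquiv (fstL x) (n - 1) + coeffEquiv (fstL x) (n + 1)) / 2) +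
      Real.pi * chi * (-coeffEquiv (fstL x) 0 *
          ((if n = 1 then 1 else 0) + (if n = -1 then 1 else 0)) -
        tau * coeffEquiv (sndL x) 0 * ((if n = 2 then 1 else 0) + (if n = -2 then 1 else 0))) := by
  have e : sndL (opBdd chi tau lam x) = (lam : ℂ) • (mulOp (circCos 1) (fstL x)) +
      (chi : ℂ) • (bar (fstL x) • (-cosL2 1) + bar (sndL x) • (-(tau : ℂ) • cosL2 2)) := rfl
  rw [e]
  simp only [map_add, map_smul, map_neg, lp.coeFn_add, lp.coeFn_smul, lp.coeFn_neg, Pi.add_apply,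
    Pi.smul_apply, Pi.neg_apply, smul_eq_mul, coeffEquiv_mulOp_cos, coeffEquiv_cosL2, bar_eq]
  push_cast
  ring

/-- This and its conjugate `source_eq_I` show that the two twists carry two different forcing terms
to the same sequence, so the two copies share one dispersion function. -/
theorem source_eq_neg_I (tau : ℝ) (n : ℤ) : source tau n = (-Complex.I) ^ n *
    (Complex.I * ((if n = 1 then 1 else 0) + (if n = -1 then 1 else 0)) +
      tau * ((if n = 2 then 1 else 0) + (if n = -2 then 1 else 0))) := by
  rw [source_apply]
  by_cases h1 : n = 1
  · subst h1; simp
  by_cases h2 : n = -1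
  · subst h2; simp
  by_cases h3 : n = 2
  · subst h3; norm_num [zpow_ofNat]
  by_cases h4 : n = -2
  · subst h4
    rw [zpow_neg]
    norm_num [zpow_ofNat]
  simp [h1, h2, h3, h4]

theorem source_eq_I (tau : ℝ) (n : ℤ) : source tau n = Complex.I ^ n *
    (-Complex.I * ((if n = 1 then 1 else 0) + (if n = -1 then 1 else 0)) +
      tau * ((if n = 2 then 1 else 0) + (if n = -2 then 1 else 0))) := by
  rw [source_apply]
  by_cases h1 : n = 1
  · subst h1; simp
  by_cases h2 : n = -1
  · subst h2; simp
  by_cases h3 : n = 2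
  · subst h3; norm_num [zpow_ofNat]
  by_cases h4 : n = -2
  · subst h4
    rw [zpow_neg]
    norm_num [zpow_ofNat]
  simp [h1, h2, h3, h4]

theorem isDoubleMode_opL (chi tau lam σ : ℝ) :
    IsDoubleMode chi tau lam σ (opL chi tau lam σ) vecModeEquiv := by
  intro x y
  rw [opL_iff, ModeRel, ModeRel, ← forall_and, ← forall_and]
  refine forall_congr' fun n => ?_
  have hI : (Complex.I : ℂ) ^ n ≠ 0 := zpow_ne_zero _ Complex.I_ne_zero
  have hI' : (-Complex.I : ℂ) ^ n ≠ 0 := zpow_ne_zero _ (neg_ne_zero.2 Complex.I_ne_zero)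
  have hm : (Complex.I : ℂ) ^ (n - 1) = -Complex.I * Complex.I ^ n := by
    rw [zpow_sub_one₀ Complex.I_ne_zero, Complex.inv_I, mul_comm]
  have hp : (Complex.I : ℂ) ^ (n + 1) = Complex.I * Complex.I ^ n := by
    rw [zpow_add_one₀ Complex.I_ne_zero, mul_comm]
  have hm' : (-Complex.I : ℂ) ^ (n - 1) = Complex.I * (-Complex.I) ^ n := by
    rw [zpow_sub_one₀ (neg_ne_zero.2 Complex.I_ne_zero), inv_neg, Complex.inv_I, neg_neg, mul_comm]
  have hp' : (-Complex.I : ℂ) ^ (n + 1) = -Complex.I * (-Complex.I) ^ n := by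
    rw [zpow_add_one₀ (neg_ne_zero.2 Complex.I_ne_zero), mul_comm]
  rw [driftOp_apply, driftOp_apply, coeffEquiv_fstL_opBdd, coeffEquiv_sndL_opBdd]
  simp only [vecModeEquiv_fst, vecModeEquiv_snd, hm, hp, hm', hp', zpow_zero, one_mul]
  nth_rewrite 1 [source_eq_neg_I]
  rw [source_eq_I]
  generalize ((if n = 1 then 1 else 0) + (if n = -1 then 1 else 0) : ℂ) = δ₁
  generalize ((if n = 2 then 1 else 0) + (if n = -2 then 1 else 0) : ℂ) = δ₂
  generalize coeffEquiv (fstL x) (n - 1) = am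
  generalize coeffEquiv (fstL x) (n + 1) = ap
  generalize coeffEquiv (sndL x) (n - 1) = bm
  generalize coeffEquiv (sndL x) (n + 1) = bp
  generalize coeffEquiv (fstL x) 0 = a0
  generalize coeffEquiv (sndL x) 0 = b0
  generalize coeffEquiv (fstL x) n = a
  generalize coeffEquiv (sndL x) n = b
  generalize coeffEquiv (fstL y) n = c
  generalize coeffEquiv (sndL y) n = d
  generalize (Complex.I : ℂ) ^ n = s at *
  generalize (-Complex.I : ℂ) ^ n = t at *
  have hII := Complex.I_mul_I
  push_cast
  -- `A` and `B` are the residuals of the two component equations. Up to invertible twists the mode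
  -- equations say `A + i B = 0` and `A - i B = 0`.
  obtain ⟨A, hA⟩ : ∃ A, A = c + σ * n ^ 2 * a + lam * ((bm + bp) / 2) -
    Real.pi * chi * (-tau * a0 * δ₂ + b0 * δ₁) := ⟨_, rfl⟩
  obtain ⟨B, hB⟩ : ∃ B, B = d + σ * n ^ 2 * b - lam * ((am + ap) / 2) -
    Real.pi * chi * (-a0 * δ₁ - tau * b0 * δ₂) := ⟨_, rfl⟩
  constructor
  · rintro ⟨h1, h2⟩
    constructor
    · linear_combination t * h1 + t * Complex.I * h2 +
        t * (-lam / 2 * (bm + bp) + Real.pi * chi * b0 * δ₁) * hII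
    · linear_combination s * h1 - s * Complex.I * h2 +
        s * (-lam / 2 * (bm + bp) + Real.pi * chi * b0 * δ₁) * hII
  · rintro ⟨h1, h2⟩
    have e1 : A + Complex.I * B = 0 := by
      refine (mul_eq_zero.1 ?_).resolve_left hI'
      rw [hA, hB]
      linear_combination h1 - t * (-lam / 2 * (bm + bp) + Real.pi * chi * b0 * δ₁) * hII
    have e2 : A - Complex.I * B = 0 := by
      refine (mul_eq_zero.1 ?_).resolve_left hI
      rw [hA, hB]
      linear_combination h2 - s * (-lam / 2 * (bm + bp) + Real.pi * chi * b0 * δ₁) * hII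
    have hA0 : A = 0 := by linear_combination (e1 + e2) / 2
    have hB0 : B = 0 := by linear_combination -Complex.I / 2 * (e1 - e2) + B * hII
    constructor
    · linear_combination hA0 - hA
    · linear_combination hB0 - hB

end AngularOperator

/-! ### The main theorem -/

theorem mainTheorem9 (chi tau lam : ℝ) (hchi : 0 < chi) (htau : 0 < tau) (hlam : 0 < lam)
    (hcond : lam < 2 * Real.pi * chi * (tau + 1)) :
    ∃ σstar : ℝ, 0 < σstar ∧ ∀ σ : ℝ, 0 ≤ σ → σ < σstar →
      ∃ μ : ℝ, 0 < μ ∧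
        AngularOperator.IsEigenvalue (AngularOperator.opL chi tau lam σ) (μ : ℂ) ∧
        AngularOperator.IsIsolated (AngularOperator.opL chi tau lam σ) (μ : ℂ) ∧
        Module.finrank ℂ
          (AngularOperator.eigenspace (AngularOperator.opL chi tau lam σ) (μ : ℂ)) = 2 ∧
        Module.finrank ℂ
          (AngularOperator.genEigenspace (AngularOperator.opL chi tau lam σ) (μ : ℂ)) = 2 := by
  obtain ⟨σstar, hs, H⟩ := AngularOperator.exists_simple_root_disp hchi htau hlam hcond
  refine ⟨σstar, hs, fun σ h0 h1 => ?_⟩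
  obtain ⟨μ, hμ, hD, hD'⟩ := H σ h0 h1
  have hT := AngularOperator.isDoubleMode_opL chi tau lam σ
  have hre : 0 < (μ : ℂ).re := by simpa
  have hfin := hT.finrank_eigenspace h0 hre hD
  refine ⟨μ, hμ, fun hbot => ?_, hT.isIsolated h0 hre hD', hfin, ?_⟩
  · rw [hbot, finrank_bot] at hfin
    exact absurd hfin (by norm_num)
  · rw [hT.genEigenspace_eq h0 hre hD hD', hfin]
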